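/- Consider the linear stochastic system $x_{k+1}=Ax_k+\omega_k$, $y_k=Cx_k+v_k$, $k=0,1,2,\dots$, with $x_k\in\mathbb R^n$, $y_k\in\mathbb R^m$, and an external information source $y^{\mathrm e}_k=C^{\mathrm e}x_k+v^{\mathrm e}_k\in\mathbb R^{\tilde m}$. The noises $\{\omega_k\}$, $\{v_k\}$, $\{v^{\mathrm e}_k\}$ are i.i.d. zero-mean Gaussian with positive definite covariances $Q$, $R$, $R^{\mathrm e}$; the initial state $x_0$ is Gaussian with arbitrary mean and arbitrary positive semidefinite covariance $S_0$; and $x_0$ and all the noise vectors are mutually independent. Write $y^{\mathrm c}_k=[y_k^{\mathsf T},y_k^{\mathrm e\mathsf T}]^{\mathsf T}$, $\bar C=[C^{\mathsf T},C^{\mathrm e\mathsf T}]^{\mathsf T}$, $\bar R=\operatorname{diag}(R,R^{\mathrm e})$ and $$\operatorname{Ric}(A,C,Q,R,P)=APA^{\mathsf T}+Q-APC^{\mathsf T}(CPC^{\mathsf T}+R)^{-1}CPA^{\mathsf T}.$$ Assume that $(A,\bar C)$ is detectable (as is the case if $(A,C)$ or $(A,C^{\mathrm e})$ is), that is, some $K$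 makes all eigenvalues of $A-K\bar C$ have modulus less than $1$. Let $$\bar x_k=\mathbb E[x_k\mid y^{\mathrm c}_0,\dots,y^{\mathrm c}_{k-1}],\qquad \hat x_{k+1}=\mathbb E[x_{k+1}\mid y_0,\dots,y_k,\,y^{\mathrm e}_0,\dots,y^{\mathrm e}_{k-d}]\quad(0\le d\le k),$$ and let $\bar P_0=S_0$, $\bar P_{k+1}=\operatorname{Ric}(A,\bar C,Q,\bar R,\bar P_k)$. For a positive semidefinite $P$ put $P^{(1)}=P$, $P^{(l+1)}=\operatorname{Ric}(A,C,Q,R,P^{(l)})$, $L^{(l)}=AP^{(l)}C^{\mathsf T}(CP^{(l)}C^{\mathsf T}+R)^{-1}$ and $\Phi_{d-l}=(A-L^{(d)}C)(A-L^{(d-1)}C)\cdots(A-L^{(l+1)}C)$ for $0\le l\le d$, with $\Phi_0=I$, and consider the expression $$(\ast)\qquad \Phi_d\,\bar x_{k-d+1}+\sum_{l=1}^{d}\Phi_{d-l}L^{(l)}y_{k-d+l}.$$ Then: 1. The equation $\bar P=\operatorname{Ric}(A,\bar C,Q,\bar R,\bar P)$ has exactly one positive semidefinite solution $\bar P$.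 2. The centralized prediction is given by the Kalman filter: almost surely $\bar x_0=\mathbb E[x_0]$ and $\bar x_{k+1}=A\bar x_k+\bar L_k(y^{\mathrm c}_k-\bar C\bar x_k)$ with $\bar L_k=A\bar P_k\bar C^{\mathsf T}(\bar C\bar P_k\bar C^{\mathsf T}+\bar R)^{-1}$. 3. For all $0\le d\le k$, $\hat x_{k+1}$ equals $(\ast)$ with $P^{(1)}=\bar P_{k-d+1}$ almost surely, and $(\ast)$ with $P^{(1)}=\bar P_{k-d+1}$ minimizes the mean square error $\mathbb E\|x_{k+1}-z\|^2$ over all predictors $z$ measurable with respect to $y_0,\dots,y_k,y^{\mathrm e}_0,\dots,y^{\mathrm e}_{k-d}$. 4. The steady-state form of this MMSE predictor is $(\ast)$ with $P^{(1)}=\bar P$: as $k\to\infty$, $\bar P_k\to\bar P$; all the matrices $\Phi_{d-l}$ and $L^{(l)}$ computed from $P^{(1)}=\bar P_k$ converge to those computed from $P^{(1)}=\bar P$; and for every $d$ the mean square difference between $\hat x_{k+1}$ and $(\ast)$ with $P^{(1)}=\bar P$ tends to $0$. If $S_0=\bar P$ (the centralized filter is in its steady state from the start), then for all $0\le d\le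 k$, $\hat x_{k+1}$ equals $(\ast)$ with $P^{(1)}=\bar P$ almost surely, and that expression is an MMSE predictor of $x_{k+1}$ from $y_0,\dots,y_k,y^{\mathrm e}_0,\dots,y^{\mathrm e}_{k-d}$. -/

import Mathlib

open MeasureTheory ProbabilityTheory Filter Topology
open scoped ENNReal Matrix

namespace DelayedKalman

section Matrices

variable {n p : Type} [Fintype n] [DecidableEq n] [Fintype p] [DecidableEq p]

/-- The Riccati operator
`Ric(A, C, Q, R, P) = A P Aᵀ + Q - A P Cᵀ (C P Cᵀ + R)⁻¹ C P Aᵀ`. -/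
noncomputable def ric (A : Matrix n n ℝ) (C : Matrix p n ℝ) (Q : Matrix n n ℝ)
    (R : Matrix p p ℝ) (P : Matrix n n ℝ) : Matrix n n ℝ :=
  A * P * Aᵀ + Q - A * P * Cᵀ * (C * P * Cᵀ + R)⁻¹ * C * P * Aᵀ

/-- The Kalman (prediction) gain `A P Cᵀ (C P Cᵀ + R)⁻¹`. -/
noncomputable def gain (A : Matrix n n ℝ) (C : Matrix p n ℝ) (R : Matrix p p ℝ)
    (P : Matrix n n ℝ) : Matrix n p ℝ :=
  A * P * Cᵀ * (C * P * Cᵀ + R)⁻¹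

/-- `(A, C)` is detectable: some observer gain `K` makes every eigenvalue of `A - K C`
lie strictly inside the complex unit disc. -/
def Detectable (A : Matrix n n ℝ) (C : Matrix p n ℝ) : Prop :=
  ∃ K : Matrix n p ℝ, spectralRadius ℂ ((A - K * C).map (algebraMap ℝ ℂ)) < 1

/-- `P^(l)`, for `l ≥ 1`: the recursion `P^(l+1) = Ric(A, C, Q, R, P^(l))` started at
`P^(1) = P`.  (The index `l = 0` is never used.) -/
noncomputable def localCov (A : Matrix n n ℝ) (C : Matrix p n ℝ) (Q : Matrix n n ℝ)
    (R : Matrix p p ℝ) (P : Matrix n n ℝ) (l : ℕ) : Matrix n n ℝ :=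
  (ric A C Q R)^[l - 1] P

/-- `L^(l) = A P^(l) Cᵀ (C P^(l) Cᵀ + R)⁻¹`, with `P^(1) = P`. -/
noncomputable def localGain (A : Matrix n n ℝ) (C : Matrix p n ℝ) (Q : Matrix n n ℝ)
    (R : Matrix p p ℝ) (P : Matrix n n ℝ) (l : ℕ) : Matrix n p ℝ :=
  gain A C R (localCov A C Q R P l)

/-- `transition A C Q R P l j` is the product
`(A - L^(l+j) C) ⋯ (A - L^(l+2) C) (A - L^(l+1) C)` of `j` factors, later factors to the left. -/
noncomputable def transition (A : Matrix n n ℝ) (C : Matrix p n ℝ) (Q : Matrix n n ℝ)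
    (R : Matrix p p ℝ) (P : Matrix n n ℝ) (l : ℕ) : ℕ → Matrix n n ℝ
  | 0 => 1
  | j + 1 => (A - localGain A C Q R P (l + j + 1) * C) * transition A C Q R P l j

/-- `Φ_{d-l} = ∏_{i=l+1}^{d} (A - L^(i) C)`, with `P^(1) = P` and larger indices to the left. -/
noncomputable def Phi (A : Matrix n n ℝ) (C : Matrix p n ℝ) (Q : Matrix n n ℝ)
    (R : Matrix p p ℝ) (P : Matrix n n ℝ) (d l : ℕ) : Matrix n n ℝ :=
  transition A C Q R P l (d - l)

/-- The delayed predictor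
`Φ_d z + ∑_{l=1}^{d} Φ_{d-l} L^(l) y_{k-d+l}` of `x_{k+1}`, with `P^(1) = P`, as a function of the
centralized prediction `z` of `x_{k-d+1}` and of the local outputs `y`. -/
noncomputable def delayedPredictor (A : Matrix n n ℝ) (C : Matrix p n ℝ) (Q : Matrix n n ℝ)
    (R : Matrix p p ℝ) (P : Matrix n n ℝ) (d k : ℕ)
    (z : EuclideanSpace ℝ n) (y : ℕ → EuclideanSpace ℝ p) : EuclideanSpace ℝ n :=
  (Phi A C Q R P d 0).toEuclideanLin z
    + ∑ l ∈ Finset.Icc 1 d,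
        (Phi A C Q R P d l * localGain A C Q R P l).toEuclideanLin (y (k - d + l))

end Matrices

section Model

variable {n m m' : ℕ}

/-- The centralized output matrix: `C` stacked on top of `Cᵉ`. -/
def stackC (C : Matrix (Fin m) (Fin n) ℝ) (Ce : Matrix (Fin m') (Fin n) ℝ) :
    Matrix (Fin m ⊕ Fin m') (Fin n) ℝ :=
  Matrix.fromRows C Ce

/-- The centralized measurement noise covariance `diag(R, Rᵉ)`. -/
def diagR (R : Matrix (Fin m) (Fin m) ℝ) (Re : Matrix (Fin m') (Fin m') ℝ) :
    Matrix (Fin m ⊕ Fin m') (Fin m ⊕ Fin m') ℝ :=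
  Matrix.fromBlocks R 0 0 Re

/-- The centralized observation: `y` stacked on top of `yᵉ`. -/
def stackY (y : EuclideanSpace ℝ (Fin m)) (ye : EuclideanSpace ℝ (Fin m')) :
    EuclideanSpace ℝ (Fin m ⊕ Fin m') :=
  WithLp.toLp 2 (Sum.elim y.ofLp ye.ofLp)

/-- Labels of the sources of randomness: the initial state, and, for every time, the process
noise, the local measurement noise and the external measurement noise. -/
inductive Source : Type
  | init : Source
  | process (k : ℕ) : Source
  | loc (k : ℕ) : Source
  | ext (k : ℕ) : Source

/-- The dimension of each source of randomness. -/
def Source.dim (n m m' : ℕ) : Source → ℕ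
  | .init => n
  | .process _ => n
  | .loc _ => m
  | .ext _ => m'

/-- The initial state and the three noise sequences as one family of random vectors. -/
def sourceFamily {Ω : Type*} (x0 : Ω → EuclideanSpace ℝ (Fin n))
    (w : ℕ → Ω → EuclideanSpace ℝ (Fin n)) (v : ℕ → Ω → EuclideanSpace ℝ (Fin m))
    (ve : ℕ → Ω → EuclideanSpace ℝ (Fin m')) :
    (i : Source) → Ω → EuclideanSpace ℝ (Fin (i.dim n m m'))
  | .init => x0
  | .process k => w k
  | .loc k => v k
  | .ext k => ve k

/-- The linear stochastic system `x_{k+1} = A x_k + ω_k`, `y_k = C x_k + v_k` with external source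
`yᵉ_k = Cᵉ x_k + vᵉ_k`: the noises are i.i.d. centred Gaussian with covariances `Q`, `R`, `Rᵉ`, the
initial state is Gaussian with mean `x₀` and covariance `S₀` (possibly singular), and the
initial state and all noise vectors are mutually independent. -/
structure IsLinearGaussianSystem {Ω : Type*} [MeasurableSpace Ω] (μ : Measure Ω)
    (A : Matrix (Fin n) (Fin n) ℝ) (C : Matrix (Fin m) (Fin n) ℝ) (Ce : Matrix (Fin m') (Fin n) ℝ)
    (Q : Matrix (Fin n) (Fin n) ℝ) (R : Matrix (Fin m) (Fin m) ℝ)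
    (Re : Matrix (Fin m') (Fin m') ℝ)
    (x₀ : EuclideanSpace ℝ (Fin n)) (S₀ : Matrix (Fin n) (Fin n) ℝ)
    (x w : ℕ → Ω → EuclideanSpace ℝ (Fin n)) (y v : ℕ → Ω → EuclideanSpace ℝ (Fin m))
    (ye ve : ℕ → Ω → EuclideanSpace ℝ (Fin m')) : Prop where
  state_eq : ∀ k ω, x (k + 1) ω = A.toEuclideanLin (x k ω) + w k ω
  output_eq : ∀ k ω, y k ω = C.toEuclideanLin (x k ω) + v k ω
  external_eq : ∀ k ω, ye k ω = Ce.toEuclideanLin (x k ω) + ve k ω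
  measurable_init : Measurable (x 0)
  measurable_process : ∀ k, Measurable (w k)
  measurable_local : ∀ k, Measurable (v k)
  measurable_external : ∀ k, Measurable (ve k)
  law_init : μ.map (x 0) = multivariateGaussian x₀ S₀
  law_process : ∀ k, μ.map (w k) = multivariateGaussian 0 Q
  law_local : ∀ k, μ.map (v k) = multivariateGaussian 0 R
  law_external : ∀ k, μ.map (ve k) = multivariateGaussian 0 Re
  indep : iIndepFun (sourceFamily (x 0) w v ve) μ

/-- The information `σ(y_0, …, y_{a-1}, yᵉ_0, …, yᵉ_{b-1})`. -/
abbrev info {Ω : Type*} (y : ℕ → Ω → EuclideanSpace ℝ (Fin m))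
    (ye : ℕ → Ω → EuclideanSpace ℝ (Fin m')) (a b : ℕ) : MeasurableSpace Ω :=
  (⨆ i ∈ Finset.range a, MeasurableSpace.comap (y i) inferInstance)
    ⊔ (⨆ i ∈ Finset.range b, MeasurableSpace.comap (ye i) inferInstance)

/-- The centralized prediction `x̄_k = E[x_k | y_0, yᵉ_0, …, y_{k-1}, yᵉ_{k-1}]`. -/
noncomputable def centralPrediction {Ω : Type*} [MeasurableSpace Ω] (μ : Measure Ω)
    (x : ℕ → Ω → EuclideanSpace ℝ (Fin n)) (y : ℕ → Ω → EuclideanSpace ℝ (Fin m))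
    (ye : ℕ → Ω → EuclideanSpace ℝ (Fin m')) (k : ℕ) : Ω → EuclideanSpace ℝ (Fin n) :=
  μ[x k | info y ye k k]

/-- The prediction with delayed external outputs (for `d ≤ k`):
`x̂_{k+1} = E[x_{k+1} | y_0, …, y_k, yᵉ_0, …, yᵉ_{k-d}]`. -/
noncomputable def delayedCondExp {Ω : Type*} [MeasurableSpace Ω] (μ : Measure Ω)
    (x : ℕ → Ω → EuclideanSpace ℝ (Fin n)) (y : ℕ → Ω → EuclideanSpace ℝ (Fin m))
    (ye : ℕ → Ω → EuclideanSpace ℝ (Fin m')) (d k : ℕ) : Ω → EuclideanSpace ℝ (Fin n) :=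
  μ[x (k + 1) | info y ye (k + 1) (k - d + 1)]

/-- `Z` is a minimum-mean-square-error predictor of `X` from the information `F`: it is
`F`-measurable, and no `F`-measurable random vector has a smaller mean square error. -/
def IsMMSEPredictor {Ω : Type*} [MeasurableSpace Ω] (μ : Measure Ω) (F : MeasurableSpace Ω)
    (X Z : Ω → EuclideanSpace ℝ (Fin n)) : Prop :=
  Measurable[F] Z ∧
    ∀ W : Ω → EuclideanSpace ℝ (Fin n), Measurable[F] W →
      ∫⁻ ω, ‖X ω - Z ω‖ₑ ^ 2 ∂μ ≤ ∫⁻ ω, ‖X ω - W ω‖ₑ ^ 2 ∂μ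

end Model

end DelayedKalman

set_option linter.unusedSectionVars false

/-! Probabilistic half. Everything is carried by one invariant, `IsFilter`: an estimate is
measurable in the available information F, and its error is centred Gaussian with known covariance
and independent of F. Such an estimate is a version of the conditional expectation, and it is MMSE
by orthogonality. A Kalman step preserves the invariant (`filter_step`, `IsFilter.step`): the gain
is exactly the matrix making the new error uncorrelated with the innovation, and joint Gaussianity
upgrades this to independence. Running the step on stacked outputs gives the centralized filter.
Freezing the external outputs after time k - d and running d further steps on local outputs alone
gives (∗), whose recursive form is `delayedPredictor_succ`.

Riccati half. For positive semidefinite P, Ric(P) is the minimum over all gains K, in the Loewner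
order, of the Joseph update, which is affine and monotone in P (`josephUpdate_eq`). Hence Ric is
monotone and concave on the positive semidefinite cone, and Q ≤ Ric(P). As Q is positive definite, a
fixed point Pbar satisfies δ Pbar ≤ Q for some δ > 0, and concavity squeezes every orbit between
multiples of Pbar whose factors tend to 1 geometrically. Convergence and uniqueness follow with no
stability analysis of the closed loop. Detectability serves only for existence: a constant
stabilizing gain bounds the increasing orbit of 0.

The two halves meet in `tendsto_delayed_gap`: for fixed d the predictors built from Pk and from Pbar
differ through finitely many convergent gains acting on innovations of convergent covariance. -/

namespace DelayedKalman

/-! ### Order properties of the Riccati operator and convergence of its iterates -/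

section Riccati

open scoped MatrixOrder

variable {n p : Type} [Fintype n] [DecidableEq n] [Fintype p] [DecidableEq p]

/-- The covariance update produced by an arbitrary observer gain `K`. -/
noncomputable def josephUpdate (A : Matrix n n ℝ) (C : Matrix p n ℝ) (Q : Matrix n n ℝ)
    (R : Matrix p p ℝ) (P : Matrix n n ℝ) (K : Matrix n p ℝ) : Matrix n n ℝ :=
  (A - K * C) * P * (A - K * C)ᵀ + Q + K * R * Kᵀ

variable {A : Matrix n n ℝ} {C : Matrix p n ℝ} {Q : Matrix n n ℝ} {R : Matrix p p ℝ}

lemma posSemidef_congr {m k : Type} [Fintype m] [Fintype k] {P : Matrix m m ℝ}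
    (hP : P.PosSemidef) (B : Matrix k m ℝ) : (B * P * Bᵀ).PosSemidef := by
  simpa [Matrix.conjTranspose_eq_transpose_of_trivial] using hP.mul_mul_conjTranspose_same B

lemma transpose_eq_of_posSemidef {m : Type} {P : Matrix m m ℝ}
    (hP : P.PosSemidef) : Pᵀ = P := by
  simpa [Matrix.conjTranspose_eq_transpose_of_trivial] using hP.isHermitian.eq

lemma innovation_posDef (hR : R.PosDef) {P : Matrix n n ℝ} (hP : P.PosSemidef) :
    (C * P * Cᵀ + R).PosDef :=
  Matrix.PosDef.posSemidef_add (posSemidef_congr hP C) hR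

lemma gain_mul_innovation (hR : R.PosDef) {P : Matrix n n ℝ} (hP : P.PosSemidef) :
    gain A C R P * (C * P * Cᵀ + R) = A * P * Cᵀ := by
  have h := (innovation_posDef (C := C) hR hP).isUnit
  rw [gain, Matrix.nonsing_inv_mul_cancel_right _ _ ((Matrix.isUnit_iff_isUnit_det _).1 h)]

/-- Completion of the square in `K`: with S = C P Cᵀ + R and L the Kalman gain, the linear terms
match because L S = A P Cᵀ. The optimality of L, and through it monotonicity and concavity of `ric`,
come from this identity. -/
lemma josephUpdate_eq (hR : R.PosDef) {P : Matrix n n ℝ} (hP : P.PosSemidef)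
    (K : Matrix n p ℝ) :
    josephUpdate A C Q R P K = ric A C Q R P
      + (K - gain A C R P) * (C * P * Cᵀ + R) * (K - gain A C R P)ᵀ := by
  have h1 := gain_mul_innovation (A := A) (C := C) hR hP
  have hS := transpose_eq_of_posSemidef (innovation_posDef (C := C) hR hP).posSemidef
  have hPt := transpose_eq_of_posSemidef hP
  have h2 : (C * P * Cᵀ + R) * (gain A C R P)ᵀ = C * P * Aᵀ := by
    have := congrArg Matrix.transpose h1
    rw [Matrix.transpose_mul, hS] at this
    rw [this]
    simp [Matrix.transpose_mul, hPt, Matrix.mul_assoc]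
  have hric : ric A C Q R P = A * P * Aᵀ + Q - gain A C R P * (C * P * Aᵀ) := by
    simp only [ric, gain, Matrix.mul_assoc]
  rw [hric]
  have e1 : (K - gain A C R P) * (C * P * Cᵀ + R) * (K - gain A C R P)ᵀ =
      K * (C * P * Cᵀ + R) * Kᵀ - K * ((C * P * Cᵀ + R) * (gain A C R P)ᵀ)
      - gain A C R P * (C * P * Cᵀ + R) * Kᵀ
      + gain A C R P * ((C * P * Cᵀ + R) * (gain A C R P)ᵀ) := by
    simp only [Matrix.transpose_sub, Matrix.sub_mul, Matrix.mul_sub, Matrix.mul_assoc]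
    abel
  rw [e1, h1, h2, josephUpdate, Matrix.transpose_sub, Matrix.transpose_mul]
  simp only [Matrix.sub_mul, Matrix.mul_sub, Matrix.add_mul, Matrix.mul_add, Matrix.mul_assoc]
  abel

lemma josephUpdate_gain (hR : R.PosDef) {P : Matrix n n ℝ} (hP : P.PosSemidef) :
    josephUpdate A C Q R P (gain A C R P) = ric A C Q R P := by
  simp [josephUpdate_eq hR hP]

lemma ric_le_josephUpdate (hR : R.PosDef) {P : Matrix n n ℝ} (hP : P.PosSemidef)
    (K : Matrix n p ℝ) : ric A C Q R P ≤ josephUpdate A C Q R P K := by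
  rw [josephUpdate_eq hR hP K]
  exact le_add_of_nonneg_right (Matrix.nonneg_iff_posSemidef.2
    (posSemidef_congr (innovation_posDef hR hP).posSemidef _))

lemma conj_mono {m k : Type} [Fintype m] [Fintype k] {P P' : Matrix m m ℝ} (h : P ≤ P')
    (B : Matrix k m ℝ) : B * P * Bᵀ ≤ B * P' * Bᵀ := by
  rw [Matrix.le_iff] at h ⊢
  simpa [Matrix.mul_sub, Matrix.sub_mul] using posSemidef_congr h B

lemma josephUpdate_mono {P P' : Matrix n n ℝ} (h : P ≤ P') (K : Matrix n p ℝ) :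
    josephUpdate A C Q R P K ≤ josephUpdate A C Q R P' K := by
  simp only [josephUpdate]
  gcongr
  exact conj_mono h _

/-- The gain that is optimal for `P'` is used as a suboptimal gain for `P`; the Joseph update with a
fixed gain is monotone. -/
lemma ric_mono (hR : R.PosDef) {P P' : Matrix n n ℝ} (hP : P.PosSemidef) (h : P ≤ P') :
    ric A C Q R P ≤ ric A C Q R P' := by
  have hP' : P'.PosSemidef :=
    Matrix.nonneg_iff_posSemidef.1 ((Matrix.nonneg_iff_posSemidef.2 hP).trans h)
  rw [← josephUpdate_gain hR hP']
  exact (ric_le_josephUpdate hR hP _).trans (josephUpdate_mono h _)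

/-- Concavity along the segment from 0, where `ric` takes the value `Q`. With the gain optimal for
`t • P` held fixed, the Joseph update is affine in the covariance, and the leftover (1 - t) K R Kᵀ
is nonnegative. -/
lemma smul_ric_add_le_ric_smul (hR : R.PosDef) {P : Matrix n n ℝ} (hP : P.PosSemidef)
    {t : ℝ} (ht0 : 0 ≤ t) (ht1 : t ≤ 1) :
    t • ric A C Q R P + (1 - t) • Q ≤ ric A C Q R (t • P) := by
  have htP : (t • P).PosSemidef := hP.smul ht0
  set K := gain A C R (t • P) with hK
  have h1 : t • ric A C Q R P ≤ t • josephUpdate A C Q R P K := by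
    rw [Matrix.le_iff, ← smul_sub]
    exact (Matrix.le_iff.1 (ric_le_josephUpdate hR hP K)).smul ht0
  have h2 : 0 ≤ (1 - t) • (K * R * Kᵀ) := Matrix.nonneg_iff_posSemidef.2
    ((posSemidef_congr hR.posSemidef K).smul (by linarith))
  rw [← josephUpdate_gain hR htP, ← hK]
  have e : josephUpdate A C Q R (t • P) K
      = t • josephUpdate A C Q R P K + (1 - t) • Q + (1 - t) • (K * R * Kᵀ) := by
    simp only [josephUpdate, Matrix.mul_smul, Matrix.smul_mul]
    module
  rw [e]
  exact (add_le_add_left h1 _).trans (le_add_of_nonneg_right h2)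

lemma le_ric (hR : R.PosDef) {P : Matrix n n ℝ} (hP : P.PosSemidef) : Q ≤ ric A C Q R P := by
  simpa using smul_ric_add_le_ric_smul (A := A) (C := C) (Q := Q) hR
    (P := P) hP (t := 0) le_rfl zero_le_one |>.trans
      (ric_mono hR (hP.smul le_rfl) (by simpa using Matrix.nonneg_iff_posSemidef.2 hP))

lemma ric_posSemidef (hQ : Q.PosSemidef) (hR : R.PosDef) {P : Matrix n n ℝ}
    (hP : P.PosSemidef) : (ric A C Q R P).PosSemidef :=
  Matrix.nonneg_iff_posSemidef.1 ((Matrix.nonneg_iff_posSemidef.2 hQ).trans (le_ric hR hP))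

lemma ric_iterate_posSemidef (hQ : Q.PosSemidef) (hR : R.PosDef) {P : Matrix n n ℝ}
    (hP : P.PosSemidef) (k : ℕ) : ((ric A C Q R)^[k] P).PosSemidef := by
  induction k with
  | zero => simpa
  | succ k ih =>
    rw [Function.iterate_succ_apply']
    exact ric_posSemidef hQ hR ih

lemma posDef_of_le {M N : Matrix n n ℝ} (hM : M.PosDef) (h : M ≤ N) : N.PosDef := by
  have := hM.add_posSemidef (Matrix.le_iff.1 h)
  simpa using this

/-- A positive definite matrix dominates a positive multiple of any symmetric matrix. -/
lemma exists_smul_le_of_posDef {M N : Matrix n n ℝ} (hM : M.PosDef) (hN : N.PosSemidef) :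
    ∃ δ : ℝ, 0 < δ ∧ δ ≤ 1 ∧ δ • N ≤ M := by
  rcases subsingleton_or_nontrivial (Matrix n n ℝ) with hs | hnt
  · exact ⟨1, one_pos, le_rfl, (Subsingleton.elim _ _).le⟩
  obtain ⟨r, hr, hrM⟩ := (CFC.exists_pos_algebraMap_le_iff (a := M) hM.isHermitian).2
    fun x hx => (Matrix.isStrictlyPositive_iff_posDef.2 hM).spectrum_pos hx
  obtain ⟨b, hb⟩ : BddAbove (spectrum ℝ N) :=
    (isCompact_iff_compactSpace.mpr inferInstance : IsCompact (spectrum ℝ N)).bddAbove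
  have hN' : N ≤ algebraMap ℝ _ (max b r) :=
    le_algebraMap_of_spectrum_le (fun x hx => (hb hx).trans (le_max_left _ _)) hN.isHermitian
  have hpos : 0 < max b r := lt_max_of_lt_right hr
  -- `r` lies below the spectrum of `M` and `b` above that of `N`; replacing `b` by `max b r` keeps
  -- the denominator positive and the ratio at most 1.
  refine ⟨r / max b r, div_pos hr hpos, (div_le_one hpos).2 (le_max_right _ _), le_trans ?_ hrM⟩
  have := (Matrix.le_iff.1 hN').smul (div_pos hr hpos).le
  rw [Matrix.le_iff]
  convert this using 1
  simp only [smul_sub, Algebra.algebraMap_eq_smul_one, smul_smul]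
  rw [div_mul_cancel₀ _ hpos.ne']

/-- Relative to a positive semidefinite fixed point, the iterates are bounded below. -/
lemma lower_bound_iterate (hR : R.PosDef) {Pbar S : Matrix n n ℝ}
    (hP : Pbar.PosSemidef) (hfix : Pbar = ric A C Q R Pbar) (hS : S.PosSemidef) {δ : ℝ}
    (hδ0 : 0 < δ) (hδ1 : δ ≤ 1) (hδ : δ • Pbar ≤ Q) (k : ℕ) :
    (1 - (1 - δ) ^ k) • Pbar ≤ (ric A C Q R)^[k] S := by
  induction k with
  | zero => simpa using Matrix.nonneg_iff_posSemidef.2 hS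
  | succ k ih =>
    have hq0 : 0 ≤ (1 - δ) ^ k := pow_nonneg (by linarith) _
    have hq1 : (1 - δ) ^ k ≤ 1 := pow_le_one₀ (by linarith) (by linarith)
    rw [Function.iterate_succ_apply']
    refine le_trans ?_ (ric_mono hR (hP.smul (by linarith)) ih)
    refine le_trans ?_ (smul_ric_add_le_ric_smul hR hP (by linarith) (by linarith))
    rw [← hfix]
    -- With q = (1 - δ)^k, the difference (1 - q) Pbar + q Q - (1 - q (1 - δ)) Pbar equals q (Q - δ
    -- Pbar).
    have h := (Matrix.le_iff.1 hδ).smul hq0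
    rw [Matrix.le_iff]
    convert h using 1
    rw [pow_succ]
    module

/-- Relative to a positive semidefinite fixed point, the iterates are bounded above. -/
lemma iterate_upper_bound (hQ : Q.PosDef) (hR : R.PosDef) {Pbar S : Matrix n n ℝ}
    (hP : Pbar.PosSemidef) (hfix : Pbar = ric A C Q R Pbar) (hS : S.PosSemidef) {δ b : ℝ}
    (hδ1 : δ ≤ 1) (hδ : δ • Pbar ≤ Q) (hb : 0 ≤ b) (hSb : S ≤ (1 + b) • Pbar)
    (k : ℕ) : (ric A C Q R)^[k] S ≤ (1 + b * (1 - δ) ^ k) • Pbar := by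
  induction k with
  | zero => simpa using hSb
  | succ k ih =>
    have hq0 : 0 ≤ b * (1 - δ) ^ k := mul_nonneg hb (pow_nonneg (by linarith) _)
    rw [Function.iterate_succ_apply']
    refine (ric_mono hR (ric_iterate_posSemidef hQ.posSemidef hR hS k) ih).trans ?_
    set c := 1 + b * (1 - δ) ^ k with hc
    have hc0 : 0 < c := by linarith
    -- Concavity at the point c Pbar with ratio 1/c returns to the fixed point, giving Ric(c Pbar) ≤
    -- c Pbar - (c - 1) Q. Then δ Pbar ≤ Q contracts the excess c - 1 by the factor 1 - δ.
    have h1 := smul_ric_add_le_ric_smul (A := A) (C := C) (Q := Q) hR (hP.smul hc0.le)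
      (t := c⁻¹) (by positivity) (inv_le_one_of_one_le₀ (by linarith))
    rw [smul_smul, inv_mul_cancel₀ hc0.ne', one_smul, ← hfix] at h1
    have h2 := (Matrix.le_iff.1 h1).smul hc0.le
    have h3 := (Matrix.le_iff.1 hδ).smul hq0
    rw [Matrix.le_iff]
    convert h2.add h3 using 1
    simp only [smul_sub, smul_add, smul_smul]
    have e1 : c * c⁻¹ = 1 := mul_inv_cancel₀ hc0.ne'
    have e2 : c * (1 - c⁻¹) = b * (1 - δ) ^ k := by
      rw [mul_sub, e1, hc]; ring
    rw [e1, e2, hc, pow_succ]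
    module

/-- Polarization for symmetric matrices. -/
lemma entry_eq_polarization {P : Matrix n n ℝ} (hP : Pᵀ = P) (i j : n) :
    P i j = ((Pi.single i 1 + Pi.single j 1) ⬝ᵥ P *ᵥ (Pi.single i 1 + Pi.single j 1)
      - Pi.single i 1 ⬝ᵥ P *ᵥ Pi.single i 1 - Pi.single j 1 ⬝ᵥ P *ᵥ Pi.single j 1) / 2 := by
  have : P j i = P i j := congrFun (congrFun hP i) j
  simp [Matrix.mulVec_add, add_dotProduct, dotProduct_add, this]
  ring

/-- Loewner inequalities control only quadratic forms; polarization turns their convergence into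
entrywise convergence and names the limit. -/
lemma tendsto_of_forms {P : ℕ → Matrix n n ℝ} (hP : ∀ k, (P k)ᵀ = P k) {q : (n → ℝ) → ℝ}
    (h : ∀ x, Tendsto (fun k => x ⬝ᵥ P k *ᵥ x) atTop (𝓝 (q x))) :
    Tendsto P atTop (𝓝 (Matrix.of fun i j => (q (Pi.single i 1 + Pi.single j 1)
      - q (Pi.single i 1) - q (Pi.single j 1)) / 2)) := by
  refine tendsto_pi_nhds.2 fun i => tendsto_pi_nhds.2 fun j => ?_
  simp_rw [fun k => entry_eq_polarization (hP k) i j]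
  exact (((h _).sub (h _)).sub (h _)).div_const 2

lemma tendsto_of_forms_eq {P : ℕ → Matrix n n ℝ} {L : Matrix n n ℝ} (hP : ∀ k, (P k)ᵀ = P k)
    (hL : Lᵀ = L) (h : ∀ x, Tendsto (fun k => x ⬝ᵥ P k *ᵥ x) atTop (𝓝 (x ⬝ᵥ L *ᵥ x))) :
    Tendsto P atTop (𝓝 L) := by
  convert tendsto_of_forms hP h
  ext i j
  exact entry_eq_polarization hL i j

lemma form_le {P P' : Matrix n n ℝ} (h : P ≤ P') (x : n → ℝ) :
    x ⬝ᵥ P *ᵥ x ≤ x ⬝ᵥ P' *ᵥ x := by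
  have := (Matrix.le_iff.1 h).dotProduct_mulVec_nonneg x
  simp only [star_trivial, Matrix.sub_mulVec, dotProduct_sub] at this
  linarith

/-- The Riccati iterates converge to any positive semidefinite fixed point. -/
theorem ric_iterate_tendsto (hQ : Q.PosDef) (hR : R.PosDef) {Pbar S : Matrix n n ℝ}
    (hP : Pbar.PosSemidef) (hfix : Pbar = ric A C Q R Pbar) (hS : S.PosSemidef) :
    Tendsto (fun k => (ric A C Q R)^[k] S) atTop (𝓝 Pbar) := by
  obtain ⟨δ, hδ0, hδ1, hδ⟩ := exists_smul_le_of_posDef hQ hP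
  have hPd : Pbar.PosDef := posDef_of_le hQ (hfix ▸ le_ric hR hP)
  -- Since Q ≤ Pbar, the fixed point is positive definite and so dominates a multiple of any start
  -- `S`. This supplies the constant b = ε⁻¹ - 1 of the upper bound.
  obtain ⟨ε, hε0, hε1, hε⟩ := exists_smul_le_of_posDef hPd hS
  have hinv : 1 ≤ ε⁻¹ := (one_le_inv₀ hε0).2 hε1
  have hSb : S ≤ (1 + (ε⁻¹ - 1)) • Pbar := by
    rw [add_sub_cancel]
    have := (Matrix.le_iff.1 hε).smul (inv_nonneg.2 hε0.le)
    rwa [smul_sub, smul_smul, inv_mul_cancel₀ hε0.ne', one_smul, ← Matrix.le_iff] at this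
  have hpow : Tendsto (fun k : ℕ => (1 - δ) ^ k) atTop (𝓝 0) :=
    tendsto_pow_atTop_nhds_zero_of_lt_one (by linarith) (by linarith)
  refine tendsto_of_forms_eq
    (fun k => transpose_eq_of_posSemidef (ric_iterate_posSemidef hQ.posSemidef hR hS k))
    (transpose_eq_of_posSemidef hP) fun x => ?_
  have hl : Tendsto (fun k : ℕ => (1 - (1 - δ) ^ k) * (x ⬝ᵥ Pbar *ᵥ x)) atTop
      (𝓝 (x ⬝ᵥ Pbar *ᵥ x)) := by
    simpa using (hpow.const_sub 1).mul_const (x ⬝ᵥ Pbar *ᵥ x)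
  have hu : Tendsto (fun k : ℕ => (1 + (ε⁻¹ - 1) * (1 - δ) ^ k) * (x ⬝ᵥ Pbar *ᵥ x)) atTop
      (𝓝 (x ⬝ᵥ Pbar *ᵥ x)) := by
    simpa using ((hpow.const_mul (ε⁻¹ - 1)).const_add 1).mul_const (x ⬝ᵥ Pbar *ᵥ x)
  refine tendsto_of_tendsto_of_tendsto_of_le_of_le hl hu (fun k => ?_) fun k => ?_
  · simpa [Matrix.smul_mulVec, dotProduct_smul] using
      form_le (lower_bound_iterate hR hP hfix hS hδ0 hδ1 hδ k) x
  · simpa [Matrix.smul_mulVec, dotProduct_smul] using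
      form_le (iterate_upper_bound hQ hR hP hfix hS hδ1 hδ (by linarith) hSb k) x

lemma tendsto_matrix_mul {α k l r : Type*} [Fintype l] {f : Filter α} {u : α → Matrix k l ℝ}
    {v : α → Matrix l r ℝ} {U : Matrix k l ℝ} {V : Matrix l r ℝ} (hu : Tendsto u f (𝓝 U))
    (hv : Tendsto v f (𝓝 V)) : Tendsto (fun a => u a * v a) f (𝓝 (U * V)) :=
  ((continuous_fst.matrix_mul continuous_snd).tendsto (U, V)).comp (hu.prodMk_nhds hv)

/-- Continuity is claimed only at positive semidefinite points, where the innovation covariance is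
positive definite and therefore invertible. -/
lemma continuousAt_innovation_inv (hR : R.PosDef) {P : Matrix n n ℝ} (hP : P.PosSemidef) :
    ContinuousAt (fun P : Matrix n n ℝ => (C * P * Cᵀ + R)⁻¹) P := by
  have hu := (Matrix.isUnit_iff_isUnit_det _).1 (innovation_posDef (C := C) hR hP).isUnit
  have hc : Continuous (fun P : Matrix n n ℝ => C * P * Cᵀ + R) := by fun_prop
  refine ContinuousAt.comp (f := fun P : Matrix n n ℝ => C * P * Cᵀ + R) (g := Inv.inv)
    ?_ hc.continuousAt
  refine continuousAt_matrix_inv _ ?_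
  rw [Ring.inverse_eq_inv']
  exact continuousAt_inv₀ hu.ne_zero

lemma continuousAt_gain (hR : R.PosDef) {P : Matrix n n ℝ} (hP : P.PosSemidef) :
    ContinuousAt (gain A C R) P := by
  have h1 : Continuous (fun P : Matrix n n ℝ => A * P * Cᵀ) := by fun_prop
  exact tendsto_matrix_mul h1.continuousAt (continuousAt_innovation_inv hR hP)

lemma continuousAt_ric (hR : R.PosDef) {P : Matrix n n ℝ} (hP : P.PosSemidef) :
    ContinuousAt (ric A C Q R) P := by
  have h1 : Continuous (fun P : Matrix n n ℝ => A * P * Aᵀ + Q) := by fun_prop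
  have h2 : Continuous (fun P : Matrix n n ℝ => C * P * Aᵀ) := by fun_prop
  have h3 : ContinuousAt (fun P => A * P * Aᵀ + Q - gain A C R P * (C * P * Aᵀ)) P :=
    h1.continuousAt.sub (tendsto_matrix_mul (continuousAt_gain hR hP) h2.continuousAt)
  refine h3.congr (.of_forall fun P => ?_)
  simp [ric, gain, Matrix.mul_assoc]

end Riccati

/-! ### Existence and uniqueness of the Riccati fixed point; continuity of the gains -/

section Existence

open scoped MatrixOrder

variable {n p : Type} [Fintype n] [DecidableEq n] [Fintype p] [DecidableEq p]

open scoped Matrix.Norms.Frobenius in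
/-- The entries of the powers of a Schur stable matrix are uniformly dominated by a square
summable sequence. -/
lemma exists_pow_entry_bound (F : Matrix n n ℝ)
    (hF : spectralRadius ℂ (F.map (algebraMap ℝ ℂ)) < 1) :
    ∃ g : ℕ → ℝ, (∀ j, 0 ≤ g j) ∧ Summable (fun j => g j ^ 2) ∧ ∀ j a b, |(F ^ j) a b| ≤ g j := by
  set M := F.map (algebraMap ℝ ℂ) with hM
  have hpow : ∀ j, (F ^ j).map (algebraMap ℝ ℂ) = M ^ j := fun j => by
    have := map_pow (algebraMap ℝ ℂ).mapMatrix F j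
    rw [hM]
    exact this
  obtain ⟨r, hr, hr1⟩ := exists_between hF
  lift r to NNReal using (hr1.trans ENNReal.one_lt_top).ne
  have hr1' : (r : ℝ) < 1 := by exact_mod_cast hr1
  -- Gelfand's formula: for r strictly between the spectral radius and 1, the j-th roots of the
  -- norms are eventually below r. The Frobenius norm is used because it dominates every entry.
  have hev : ∀ᶠ j : ℕ in atTop, ‖M ^ j‖ ≤ (r : ℝ) ^ j := by
    filter_upwards [(spectrum.pow_nnnorm_pow_one_div_tendsto_nhds_spectralRadius M).eventually
      (gt_mem_nhds hr), eventually_gt_atTop 0] with j hj hj0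
    have hj0' : (0 : ℝ) < j := by exact_mod_cast hj0
    have h := ENNReal.rpow_le_rpow hj.le hj0'.le
    rw [← ENNReal.rpow_mul, one_div, inv_mul_cancel₀ hj0'.ne', ENNReal.rpow_one,
      ENNReal.rpow_natCast] at h
    exact_mod_cast h
  refine ⟨fun j => ‖M ^ j‖, fun j => norm_nonneg _, ?_, fun j a b => ?_⟩
  · refine Summable.of_norm_bounded_eventually_nat (g := fun j => ((r : ℝ) ^ 2) ^ j)
      (summable_geometric_of_lt_one (by positivity) (by nlinarith [r.coe_nonneg])) ?_
    filter_upwards [hev] with j hj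
    rw [← pow_mul, mul_comm 2, pow_mul, Real.norm_of_nonneg (by positivity)]
    exact pow_le_pow_left₀ (norm_nonneg _) hj 2
  · have e : |(F ^ j) a b| = ‖(M ^ j) a b‖ := by
      rw [← hpow]; simp
    have hn : ‖M ^ j‖ = √(∑ i, ∑ j', ‖(M ^ j) i j'‖ ^ (2 : ℝ)) := by
      rw [Real.sqrt_eq_rpow]
      exact Matrix.frobenius_norm_def _
    simp only [e, hn]
    refine Real.le_sqrt_of_sq_le ?_
    have h1 := Finset.single_le_sum (f := fun i => ∑ j', ‖(M ^ j) i j'‖ ^ (2 : ℝ))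
      (fun i _ => Finset.sum_nonneg fun _ _ => by positivity) (Finset.mem_univ a)
    have h2 := Finset.single_le_sum (f := fun j' => ‖(M ^ j) a j'‖ ^ (2 : ℝ))
      (fun _ _ => by positivity) (Finset.mem_univ b)
    simpa using h2.trans h1

variable {A : Matrix n n ℝ} {C : Matrix p n ℝ} {Q : Matrix n n ℝ} {R : Matrix p p ℝ}

/-- The right side is the orbit of 0 under the Joseph update with constant gain `K`; optimal gains
can only do better at each step. -/
lemma ric_iterate_zero_le (hQ : Q.PosSemidef) (hR : R.PosDef) (K : Matrix n p ℝ) (k : ℕ) :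
    (ric A C Q R)^[k] 0 ≤ ∑ j ∈ Finset.range k,
      (A - K * C) ^ j * (Q + K * R * Kᵀ) * ((A - K * C) ^ j)ᵀ := by
  induction k with
  | zero => simp
  | succ k ih =>
    rw [Function.iterate_succ_apply']
    refine (ric_le_josephUpdate hR
      (ric_iterate_posSemidef hQ hR Matrix.PosSemidef.zero k) K).trans ?_
    refine (josephUpdate_mono ih K).trans_eq ?_
    rw [Finset.sum_range_succ', josephUpdate, Matrix.mul_sum, Matrix.sum_mul, add_assoc]
    simp [pow_succ', Matrix.mul_assoc]

lemma form_sum_bounded {F M : Matrix n n ℝ}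
    (hF : spectralRadius ℂ (F.map (algebraMap ℝ ℂ)) < 1) (x : n → ℝ) :
    ∃ B, ∀ k : ℕ, x ⬝ᵥ (∑ j ∈ Finset.range k, F ^ j * M * (F ^ j)ᵀ) *ᵥ x ≤ B := by
  obtain ⟨g, hg0, hg, hgF⟩ := exists_pow_entry_bound F hF
  obtain ⟨s, hs⟩ : ∃ s, s = ∑ c, |x c| := ⟨_, rfl⟩
  set D := ∑ a, ∑ b, s * |M a b| * s with hD
  refine ⟨(∑' j, g j ^ 2) * D, fun k => ?_⟩
  have hs0 : 0 ≤ s := hs ▸ Finset.sum_nonneg fun _ _ => abs_nonneg _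
  have hD0 : 0 ≤ D := by positivity
  -- The form equals v · M v for v = (F^j)ᵀ x, and each coordinate of v is at most g j times the l¹
  -- norm `s` of x.
  have hterm : ∀ j, x ⬝ᵥ (F ^ j * M * (F ^ j)ᵀ) *ᵥ x ≤ g j ^ 2 * D := fun j => by
    set v := (F ^ j)ᵀ *ᵥ x with hv
    have hvb : ∀ a, |v a| ≤ g j * s := fun a => by
      rw [hv, hs, Matrix.mulVec, dotProduct, Finset.mul_sum]
      refine (Finset.abs_sum_le_sum_abs _ _).trans (Finset.sum_le_sum fun c _ => ?_)
      rw [abs_mul]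
      exact mul_le_mul_of_nonneg_right (hgF j c a) (abs_nonneg _)
    have e : x ⬝ᵥ (F ^ j * M * (F ^ j)ᵀ) *ᵥ x = v ⬝ᵥ M *ᵥ v := by
      rw [← Matrix.mulVec_mulVec, ← Matrix.mulVec_mulVec, ← hv, Matrix.dotProduct_mulVec,
        ← Matrix.mulVec_transpose]
    rw [e, hD]
    simp only [dotProduct, Matrix.mulVec, Finset.mul_sum]
    refine Finset.sum_le_sum fun a _ => Finset.sum_le_sum fun b _ => (le_abs_self _).trans ?_
    rw [abs_mul, abs_mul]
    have h12 : |v a| * |v b| ≤ (g j * s) * (g j * s) :=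
      mul_le_mul (hvb a) (hvb b) (abs_nonneg _) ((abs_nonneg _).trans (hvb a))
    calc |v a| * (|M a b| * |v b|) = (|v a| * |v b|) * |M a b| := by ring
      _ ≤ ((g j * s) * (g j * s)) * |M a b| := by gcongr
      _ = g j ^ 2 * (s * |M a b| * s) := by ring
  have es : x ⬝ᵥ (∑ j ∈ Finset.range k, F ^ j * M * (F ^ j)ᵀ) *ᵥ x
      = ∑ j ∈ Finset.range k, x ⬝ᵥ (F ^ j * M * (F ^ j)ᵀ) *ᵥ x := by
    rw [Matrix.sum_mulVec, dotProduct_sum]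
  rw [es]
  refine (Finset.sum_le_sum fun j _ => hterm j).trans ?_
  rw [← Finset.sum_mul]
  exact mul_le_mul_of_nonneg_right (hg.sum_le_tsum _ fun _ _ => sq_nonneg _) hD0

/-- Detectability yields a positive semidefinite solution of the Riccati equation. -/
theorem exists_ric_fixedPoint (hQ : Q.PosDef) (hR : R.PosDef) (hdet : Detectable A C) :
    ∃ P : Matrix n n ℝ, P.PosSemidef ∧ P = ric A C Q R P := by
  obtain ⟨K, hK⟩ := hdet
  set P : ℕ → Matrix n n ℝ := fun k => (ric A C Q R)^[k] 0 with hPdef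
  have hpsd : ∀ k, (P k).PosSemidef :=
    fun k => ric_iterate_posSemidef hQ.posSemidef hR Matrix.PosSemidef.zero k
  have hstep : ∀ k, P (k + 1) = ric A C Q R (P k) := fun k => Function.iterate_succ_apply' _ _ _
  -- Starting from 0, the first iterate is above the start, and monotonicity of `ric` propagates
  -- this inequality along the orbit.
  have hmono : Monotone P := monotone_nat_of_le_succ fun k => by
    induction k with
    | zero => exact Matrix.nonneg_iff_posSemidef.2 (hpsd 1)
    | succ k ih =>
      rw [hstep (k + 1)]
      conv_lhs => rw [hstep k]
      exact ric_mono hR (hpsd k) ih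
  have hlim : ∀ x : n → ℝ, ∃ l, Tendsto (fun k => x ⬝ᵥ P k *ᵥ x) atTop (𝓝 l) := fun x => by
    -- The only use of detectability: the stabilizing gain bounds each quadratic form uniformly in
    -- time, so the increasing forms converge.
    obtain ⟨B, hB⟩ := form_sum_bounded (M := Q + K * R * Kᵀ) hK x
    refine ⟨_, tendsto_atTop_ciSup (fun i j hij => form_le (hmono hij) x) ⟨B, ?_⟩⟩
    rintro _ ⟨k, rfl⟩
    exact (form_le (ric_iterate_zero_le hQ.posSemidef hR K k) x).trans (hB k)
  choose q hq using hlim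
  have hL := tendsto_of_forms (fun k => transpose_eq_of_posSemidef (hpsd k)) hq
  set L : Matrix n n ℝ := Matrix.of fun i j => (q (Pi.single i 1 + Pi.single j 1)
      - q (Pi.single i 1) - q (Pi.single j 1)) / 2
  have hLpsd : L.PosSemidef := by
    refine Matrix.PosSemidef.of_dotProduct_mulVec_nonneg ?_ fun x => ?_
    · rw [Matrix.IsHermitian, Matrix.conjTranspose_eq_transpose_of_trivial]
      refine tendsto_nhds_unique ((continuous_id.matrix_transpose.tendsto L).comp hL) ?_
      exact hL.congr fun k => (transpose_eq_of_posSemidef (hpsd k)).symm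
    · have hc : Continuous fun M : Matrix n n ℝ => star x ⬝ᵥ M *ᵥ x := by fun_prop
      exact ge_of_tendsto ((hc.tendsto L).comp hL)
        (.of_forall fun k => (hpsd k).dotProduct_mulVec_nonneg x)
  refine ⟨L, hLpsd, tendsto_nhds_unique ((tendsto_add_atTop_iff_nat 1).2 hL) ?_⟩
  exact ((continuousAt_ric hR hLpsd).tendsto.comp hL).congr fun k => (hstep k).symm

/-- Uniqueness of the positive semidefinite solution of the Riccati equation. -/
theorem ric_fixedPoint_unique (hQ : Q.PosDef) (hR : R.PosDef) {P P' : Matrix n n ℝ}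
    (hP : P.PosSemidef) (hP' : P'.PosSemidef) (h : P = ric A C Q R P) (h' : P' = ric A C Q R P') :
    P = P' := by
  refine tendsto_nhds_unique (tendsto_const_nhds.congr fun k => ?_)
    (ric_iterate_tendsto hQ hR hP' h' hP)
  exact (Function.iterate_fixed h.symm k).symm

lemma localCov_tendsto (hQ : Q.PosDef) (hR : R.PosDef) {P : ℕ → Matrix n n ℝ} {L : Matrix n n ℝ}
    (hL : L.PosSemidef) (h : Tendsto P atTop (𝓝 L)) (l : ℕ) :
    Tendsto (fun k => localCov A C Q R (P k) l) atTop (𝓝 (localCov A C Q R L l)) := by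
  simp only [localCov]
  induction l - 1 with
  | zero => simpa
  | succ j ih =>
    simp only [Function.iterate_succ_apply']
    exact (continuousAt_ric hR (ric_iterate_posSemidef hQ.posSemidef hR hL j)).tendsto.comp ih

lemma localCov_posSemidef (hQ : Q.PosDef) (hR : R.PosDef) {L : Matrix n n ℝ}
    (hL : L.PosSemidef) (l : ℕ) : (localCov A C Q R L l).PosSemidef :=
  ric_iterate_posSemidef hQ.posSemidef hR hL _

lemma localGain_tendsto (hQ : Q.PosDef) (hR : R.PosDef) {P : ℕ → Matrix n n ℝ} {L : Matrix n n ℝ}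
    (hL : L.PosSemidef) (h : Tendsto P atTop (𝓝 L)) (l : ℕ) :
    Tendsto (fun k => localGain A C Q R (P k) l) atTop (𝓝 (localGain A C Q R L l)) :=
  (continuousAt_gain hR (localCov_posSemidef hQ hR hL l)).tendsto.comp
    (localCov_tendsto hQ hR hL h l)

lemma transition_tendsto (hQ : Q.PosDef) (hR : R.PosDef) {P : ℕ → Matrix n n ℝ}
    {L : Matrix n n ℝ} (hL : L.PosSemidef) (h : Tendsto P atTop (𝓝 L)) (l j : ℕ) :
    Tendsto (fun k => transition A C Q R (P k) l j) atTop (𝓝 (transition A C Q R L l j)) := by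
  induction j with
  | zero => exact tendsto_const_nhds
  | succ j ih =>
    exact tendsto_matrix_mul (tendsto_const_nhds.sub
      (tendsto_matrix_mul (localGain_tendsto hQ hR hL h _) tendsto_const_nhds)) ih

end Existence

/-! ### The closed formula (∗) as a recursion in the delay -/

section Recursion

variable {n p : Type} [Fintype n] [DecidableEq n] [Fintype p] [DecidableEq p]

lemma toEuclideanLin_mul {r : Type} [Fintype r] [DecidableEq r] (M : Matrix r p ℝ)
    (N : Matrix p n ℝ) (x : EuclideanSpace ℝ n) :
    (M * N).toEuclideanLin x = M.toEuclideanLin (N.toEuclideanLin x) := by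
  simp [Matrix.toLpLin_apply]

lemma delayedPredictor_zero (A : Matrix n n ℝ) (C : Matrix p n ℝ) (Q : Matrix n n ℝ)
    (R : Matrix p p ℝ) (P : Matrix n n ℝ) (k : ℕ) (z : EuclideanSpace ℝ n)
    (y : ℕ → EuclideanSpace ℝ p) : delayedPredictor A C Q R P 0 k z y = z := by
  simp [delayedPredictor, Phi, transition, Matrix.toLpLin_apply]

/-- Peeling the leftmost factor off every Φ turns (∗) into one local Kalman step, the form suited to
induction on the delay. Writing k = d + t removes the truncated subtraction: t = k - d stays fixed
while `d` grows. -/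
lemma delayedPredictor_succ (A : Matrix n n ℝ) (C : Matrix p n ℝ) (Q : Matrix n n ℝ)
    (R : Matrix p p ℝ) (P : Matrix n n ℝ) (d t : ℕ) (z : EuclideanSpace ℝ n)
    (y : ℕ → EuclideanSpace ℝ p) :
    delayedPredictor A C Q R P (d + 1) (d + 1 + t) z y =
      A.toEuclideanLin (delayedPredictor A C Q R P d (d + t) z y)
      + (localGain A C Q R P (d + 1)).toEuclideanLin (y (t + (d + 1))
        - C.toEuclideanLin (delayedPredictor A C Q R P d (d + t) z y)) := by
  have hPhi : ∀ l ≤ d, Phi A C Q R P (d + 1) l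
      = (A - localGain A C Q R P (d + 1) * C) * Phi A C Q R P d l := fun l hl => by
    simp only [Phi]
    rw [show d + 1 - l = (d - l) + 1 by omega, transition, show l + (d - l) + 1 = d + 1 by omega]
  have hPhi1 : Phi A C Q R P (d + 1) (d + 1) = 1 := by simp [Phi, transition]
  have hstep : delayedPredictor A C Q R P (d + 1) (d + 1 + t) z y =
      (A - localGain A C Q R P (d + 1) * C).toEuclideanLin
        (delayedPredictor A C Q R P d (d + t) z y)
      + (localGain A C Q R P (d + 1)).toEuclideanLin (y (t + (d + 1))) := by
    simp only [delayedPredictor, Nat.add_sub_cancel_left]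
    rw [Finset.sum_Icc_succ_top (by omega), hPhi1, Matrix.one_mul, hPhi 0 (by omega), map_add,
      map_sum, toEuclideanLin_mul, add_assoc]
    congr 2
    refine Finset.sum_congr rfl fun l hl => ?_
    rw [hPhi l (Finset.mem_Icc.1 hl).2, Matrix.mul_assoc, toEuclideanLin_mul]
  rw [hstep, map_sub, LinearMap.sub_apply, toEuclideanLin_mul, map_sub]
  abel

end Recursion

/-! ### Regrouping independent σ-algebras -/

section Independence

variable {Ω : Type*} {m₁ m₂ m₃ mΩ : MeasurableSpace Ω} {μ : Measure Ω}

/-- The intersections a ∩ b with a in `m₂` and b in `m₃` form a π-system generating the join, and on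
them the probability of s ∩ a ∩ b factors in two stages. -/
lemma indep_sup_of_indep_sup [IsProbabilityMeasure μ] (h₁ : m₁ ≤ mΩ) (h₂ : m₂ ≤ mΩ) (h₃ : m₃ ≤ mΩ)
    (h₁₂ : Indep m₁ m₂ μ) (h₁₂₃ : Indep (m₁ ⊔ m₂) m₃ μ) : Indep m₁ (m₂ ⊔ m₃) μ := by
  set π : Set (Set Ω) := Set.image2 (· ∩ ·) {s | MeasurableSet[m₂] s} {s | MeasurableSet[m₃] s}
    with hπ
  have hπ_pi : IsPiSystem π := by
    rintro _ ⟨a, ha, b, hb, rfl⟩ _ ⟨c, hc, d, hd, rfl⟩ -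
    exact ⟨a ∩ c, MeasurableSet.inter ha hc, b ∩ d, MeasurableSet.inter hb hd,
      Set.inter_inter_inter_comm _ _ _ _⟩
  have hgen : m₂ ⊔ m₃ = MeasurableSpace.generateFrom π := by
    refine le_antisymm (sup_le (fun s hs => ?_) fun s hs => ?_)
      (MeasurableSpace.generateFrom_le ?_)
    · exact MeasurableSpace.measurableSet_generateFrom
        ⟨s, hs, Set.univ, MeasurableSet.univ, Set.inter_univ s⟩
    · exact MeasurableSpace.measurableSet_generateFrom
        ⟨Set.univ, MeasurableSet.univ, s, hs, Set.univ_inter s⟩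
    · rintro _ ⟨a, ha, b, hb, rfl⟩
      exact MeasurableSet.inter ((le_sup_left : m₂ ≤ m₂ ⊔ m₃) _ ha)
        ((le_sup_right : m₃ ≤ m₂ ⊔ m₃) _ hb)
  refine IndepSets.indep h₁ (sup_le h₂ h₃) (@MeasurableSpace.isPiSystem_measurableSet _ m₁) hπ_pi
    (@MeasurableSpace.generateFrom_measurableSet _ m₁).symm hgen ?_
  rw [IndepSets_iff]
  rintro s _ hs ⟨a, ha, b, hb, rfl⟩
  rw [Indep_iff] at h₁₂ h₁₂₃
  have hs' : MeasurableSet[m₁ ⊔ m₂] s := (le_sup_left : m₁ ≤ m₁ ⊔ m₂) _ hs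
  have ha' : MeasurableSet[m₁ ⊔ m₂] a := (le_sup_right : m₂ ≤ m₁ ⊔ m₂) _ ha
  have e1 := h₁₂₃ _ _ (MeasurableSet.inter hs' ha') hb
  have e2 := h₁₂₃ _ _ ha' hb
  rw [← Set.inter_assoc, e1, h₁₂ _ _ hs ha, e2, mul_assoc]

end Independence

/-! ### Centred Gaussian vectors with prescribed covariance matrix -/

section Gaussian

variable {Ω : Type*} [mΩ : MeasurableSpace Ω] {μ : Measure Ω}
variable {n p : Type} [Fintype n] [DecidableEq n] [Fintype p] [DecidableEq p]

/-- `X` is a centred Gaussian vector with covariance matrix `S`. -/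
structure IsCenteredGaussian (μ : Measure Ω) (X : Ω → EuclideanSpace ℝ n)
    (S : Matrix n n ℝ) : Prop where
  gaussian : HasGaussianLaw X μ
  mean : ∫ ω, X ω ∂μ = 0
  cov : ∀ a b : EuclideanSpace ℝ n,
    cov[fun ω => inner ℝ a (X ω), fun ω => inner ℝ b (X ω); μ] = a.ofLp ⬝ᵥ S *ᵥ b.ofLp

/-- The continuous linear map attached to a matrix. -/
noncomputable def matCLM (M : Matrix p n ℝ) : EuclideanSpace ℝ n →L[ℝ] EuclideanSpace ℝ p :=
  LinearMap.toContinuousLinearMap M.toEuclideanLin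

@[simp] lemma matCLM_apply (M : Matrix p n ℝ) (x : EuclideanSpace ℝ n) :
    matCLM M x = M.toEuclideanLin x := rfl

lemma inner_toEuclideanLin (M : Matrix p n ℝ) (a : EuclideanSpace ℝ p) (x : EuclideanSpace ℝ n) :
    inner ℝ a (M.toEuclideanLin x) = inner ℝ (Mᵀ.toEuclideanLin a) x := by
  simp only [EuclideanSpace.inner_eq_star_dotProduct, Matrix.toLpLin_apply, star_trivial]
  rw [Matrix.mulVec_transpose, dotProduct_comm, Matrix.dotProduct_mulVec, dotProduct_comm]

lemma measurable_toEuclideanLin (M : Matrix p n ℝ) :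
    Measurable (fun x : EuclideanSpace ℝ n => M.toEuclideanLin x) :=
  (matCLM M).continuous.measurable

namespace IsCenteredGaussian

lemma memLp {X : Ω → EuclideanSpace ℝ n} {S : Matrix n n ℝ} (h : IsCenteredGaussian μ X S) :
    MemLp X 2 μ := h.gaussian.memLp_two

lemma memLp_inner {X : Ω → EuclideanSpace ℝ n} {S : Matrix n n ℝ}
    (h : IsCenteredGaussian μ X S) (a : EuclideanSpace ℝ n) :
    MemLp (fun ω => inner ℝ a (X ω)) 2 μ := h.memLp.const_inner a

lemma of_law {X : Ω → EuclideanSpace ℝ n} {S : Matrix n n ℝ} {c : EuclideanSpace ℝ n}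
    [IsProbabilityMeasure μ]
    (hX : Measurable X) (hS : S.PosSemidef) (hlaw : μ.map X = multivariateGaussian c S) :
    IsCenteredGaussian μ (fun ω => X ω - c) S := by
  have hg : HasGaussianLaw X μ := ⟨by rw [hlaw]; infer_instance⟩
  have hcov : ∀ a b : EuclideanSpace ℝ n,
      cov[fun ω => inner ℝ a (X ω), fun ω => inner ℝ b (X ω); μ] = a.ofLp ⬝ᵥ S *ᵥ b.ofLp := by
    intro a b
    rw [← covarianceBilin_multivariateGaussian (μ := c) hS, covarianceBilin_apply_eq_cov
      IsGaussian.memLp_two_id, ← hlaw, covariance_map_fun (by fun_prop) (by fun_prop)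
      hX.aemeasurable]
  refine ⟨⟨?_⟩, ?_, fun a b => ?_⟩
  · have : (fun ω => X ω - c) = (fun x => x + -c) ∘ X := by
      ext ω; simp [sub_eq_add_neg]
    rw [this, ← Measure.map_map (by fun_prop) hX, hlaw]
    infer_instance
  · rw [integral_sub hg.integrable (integrable_const _), integral_const]
    have : ∫ ω, X ω ∂μ = c := by
      have h := integral_map (μ := μ) hX.aemeasurable (f := fun x => x) (by fun_prop)
      rw [← h, hlaw, integral_id_multivariateGaussian]
    simp [this]
  · simp only [inner_sub_right]
    have hi : ∀ a : EuclideanSpace ℝ n, Integrable (fun ω => inner ℝ a (X ω)) μ :=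
      fun a => hg.integrable.const_inner a
    rw [covariance_sub_const_left (hi a), covariance_sub_const_right (hi b), hcov]

lemma of_law_zero {X : Ω → EuclideanSpace ℝ n} {S : Matrix n n ℝ} [IsProbabilityMeasure μ]
    (hX : Measurable X) (hS : S.PosSemidef) (hlaw : μ.map X = multivariateGaussian 0 S) :
    IsCenteredGaussian μ X S := by
  simpa using of_law hX hS hlaw

/-- Covariance of two linear functionals of three independent centred Gaussian vectors. -/
lemma cov_linear {e w : Ω → EuclideanSpace ℝ n} {v : Ω → EuclideanSpace ℝ p}
    {P Q : Matrix n n ℝ} {R : Matrix p p ℝ} [IsProbabilityMeasure μ]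
    (he : IsCenteredGaussian μ e P) (hw : IsCenteredGaussian μ w Q) (hv : IsCenteredGaussian μ v R)
    (hew : e ⟂ᵢ[μ] w) (hev : e ⟂ᵢ[μ] v) (hwv : w ⟂ᵢ[μ] v)
    (a a' b b' : EuclideanSpace ℝ n) (c c' : EuclideanSpace ℝ p) :
    cov[fun ω => inner ℝ a (e ω) + inner ℝ b (w ω) + inner ℝ c (v ω),
      fun ω => inner ℝ a' (e ω) + inner ℝ b' (w ω) + inner ℝ c' (v ω); μ]
      = a.ofLp ⬝ᵥ P *ᵥ a'.ofLp + b.ofLp ⬝ᵥ Q *ᵥ b'.ofLp + c.ofLp ⬝ᵥ R *ᵥ c'.ofLp := by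
  have Ee := he.memLp_inner
  have Ew := hw.memLp_inner
  have Ev := hv.memLp_inner
  have ind : ∀ {q r : Type} [Fintype q] [Fintype r] {X : Ω → EuclideanSpace ℝ q}
      {Y : Ω → EuclideanSpace ℝ r} (_ : X ⟂ᵢ[μ] Y)
      (_ : ∀ s, MemLp (fun ω => inner ℝ s (X ω)) 2 μ)
      (_ : ∀ s, MemLp (fun ω => inner ℝ s (Y ω)) 2 μ) (s : EuclideanSpace ℝ q)
      (t : EuclideanSpace ℝ r),
      cov[fun ω => inner ℝ s (X ω), fun ω => inner ℝ t (Y ω); μ] = 0 := by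
    intro q r _ _ X Y h hX hY s t
    exact IndepFun.covariance_eq_zero (h.comp (φ := fun x => inner ℝ s x)
      (ψ := fun x => inner ℝ t x) (by fun_prop) (by fun_prop)) (hX s) (hY t)
  change cov[(fun ω => inner ℝ a (e ω)) + (fun ω => inner ℝ b (w ω)) + (fun ω => inner ℝ c (v ω)),
    (fun ω => inner ℝ a' (e ω)) + (fun ω => inner ℝ b' (w ω)) + (fun ω => inner ℝ c' (v ω)); μ] = _
  rw [covariance_add_left ((Ee a).add (Ew b)) (Ev c) (((Ee a').add (Ew b')).add (Ev c')),
    covariance_add_left (Ee a) (Ew b) (((Ee a').add (Ew b')).add (Ev c')),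
    covariance_add_right (Ee a) ((Ee a').add (Ew b')) (Ev c'),
    covariance_add_right (Ee a) (Ee a') (Ew b'),
    covariance_add_right (Ew b) ((Ee a').add (Ew b')) (Ev c'),
    covariance_add_right (Ew b) (Ee a') (Ew b'),
    covariance_add_right (Ev c) ((Ee a').add (Ew b')) (Ev c'),
    covariance_add_right (Ev c) (Ee a') (Ew b'), he.cov, hw.cov, hv.cov,
    ind hew Ee Ew, ind hev Ee Ev, ind hew.symm Ew Ee, ind hwv Ew Ev, ind hev.symm Ev Ee,
    ind hwv.symm Ev Ew]
  ring

/-- Independent centred Gaussian vectors stack to a centred Gaussian vector with block diagonal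
covariance. -/
lemma stack {m m' : ℕ} {v : Ω → EuclideanSpace ℝ (Fin m)} {ve : Ω → EuclideanSpace ℝ (Fin m')}
    {R : Matrix (Fin m) (Fin m) ℝ} {Re : Matrix (Fin m') (Fin m') ℝ} [IsProbabilityMeasure μ]
    (hv : IsCenteredGaussian μ v R) (hve : IsCenteredGaussian μ ve Re) (h : v ⟂ᵢ[μ] ve) :
    IsCenteredGaussian μ (fun ω => stackY (v ω) (ve ω)) (diagR R Re) := by
  have hin : ∀ (a : EuclideanSpace ℝ (Fin m ⊕ Fin m')) ω, inner ℝ a (stackY (v ω) (ve ω))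
      = inner ℝ (WithLp.toLp 2 fun i => a (Sum.inl i)) (v ω)
        + inner ℝ (WithLp.toLp 2 fun i => a (Sum.inr i)) (ve ω) := fun a ω => by
    simp [stackY, PiLp.inner_apply]
  let T : EuclideanSpace ℝ (Fin m) × EuclideanSpace ℝ (Fin m') →ₗ[ℝ]
      EuclideanSpace ℝ (Fin m ⊕ Fin m') :=
    { toFun := fun x => stackY x.1 x.2
      map_add' := fun x y => by ext i; rcases i with i | i <;> simp [stackY]
      map_smul' := fun c x => by ext i; rcases i with i | i <;> simp [stackY] }
  have hT : HasGaussianLaw (fun ω => stackY (v ω) (ve ω)) μ :=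
    (h.hasGaussianLaw hv.gaussian hve.gaussian).map_fun (LinearMap.toContinuousLinearMap T)
  refine ⟨hT, ?_, fun a b => ?_⟩
  · refine ext_inner_left ℝ fun a => ?_
    rw [← integral_inner hT.integrable, inner_zero_right]
    simp only [hin]
    rw [integral_add (hv.gaussian.integrable.const_inner _)
      (hve.gaussian.integrable.const_inner _), integral_inner hv.gaussian.integrable,
      integral_inner hve.gaussian.integrable, hv.mean, hve.mean]
    simp
  · simp only [hin]
    have ind : ∀ s t, cov[fun ω => inner ℝ s (v ω), fun ω => inner ℝ t (ve ω); μ] = 0 :=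
      fun s t => IndepFun.covariance_eq_zero (h.comp (φ := fun x => inner ℝ s x)
        (ψ := fun x => inner ℝ t x) (by fun_prop) (by fun_prop))
        (hv.memLp_inner s) (hve.memLp_inner t)
    have ind' : ∀ s t, cov[fun ω => inner ℝ t (ve ω), fun ω => inner ℝ s (v ω); μ] = 0 :=
      fun s t => by rw [covariance_comm, ind]
    change cov[(fun ω => inner ℝ _ (v ω)) + (fun ω => inner ℝ _ (ve ω)),
      (fun ω => inner ℝ _ (v ω)) + (fun ω => inner ℝ _ (ve ω)); μ] = _
    rw [covariance_add_left (hv.memLp_inner _) (hve.memLp_inner _)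
        ((hv.memLp_inner _).add (hve.memLp_inner _)),
      covariance_add_right (hv.memLp_inner _) (hv.memLp_inner _) (hve.memLp_inner _),
      covariance_add_right (hve.memLp_inner _) (hv.memLp_inner _) (hve.memLp_inner _),
      ind, ind', hv.cov, hve.cov]
    simp [dotProduct, diagR, Matrix.mulVec, Fintype.sum_sum_type]

end IsCenteredGaussian

lemma diagR_posDef {m m' : ℕ} {R : Matrix (Fin m) (Fin m) ℝ} {Re : Matrix (Fin m') (Fin m') ℝ}
    (hR : R.PosDef) (hRe : Re.PosDef) : (diagR R Re).PosDef := by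
  refine Matrix.PosDef.of_dotProduct_mulVec_pos ?_ fun x hx => ?_
  · rw [diagR, Matrix.IsHermitian, Matrix.fromBlocks_conjTranspose, hR.isHermitian.eq,
      hRe.isHermitian.eq]
    simp
  · have e : star x ⬝ᵥ diagR R Re *ᵥ x = star (x ∘ Sum.inl) ⬝ᵥ R *ᵥ (x ∘ Sum.inl)
        + star (x ∘ Sum.inr) ⬝ᵥ Re *ᵥ (x ∘ Sum.inr) := by
      simp [dotProduct, diagR, Matrix.mulVec, Fintype.sum_sum_type]
    rw [e]
    by_cases h : x ∘ Sum.inl = 0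
    · have h' : x ∘ Sum.inr ≠ 0 := fun h' => hx <| by
        ext i
        rcases i with i | i
        · exact congrFun h i
        · exact congrFun h' i
      exact add_pos_of_nonneg_of_pos (hR.posSemidef.dotProduct_mulVec_nonneg _)
        (hRe.dotProduct_mulVec_pos h')
    · exact add_pos_of_pos_of_nonneg (hR.dotProduct_mulVec_pos h)
        (hRe.posSemidef.dotProduct_mulVec_nonneg _)

end Gaussian

/-! ### One Kalman step for the prediction error -/

section FilterStep

variable {Ω : Type*} {F G : MeasurableSpace Ω} [mΩ : MeasurableSpace Ω] {μ : Measure Ω}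
variable {n p : Type} [Fintype n] [DecidableEq n] [Fintype p] [DecidableEq p]

/-- One step of the Kalman predictor: the new error is centred Gaussian with the Riccati covariance
and is independent of the old information together with the innovation. -/
theorem filter_step [IsProbabilityMeasure μ] (hFG : F ≤ G) (hG : G ≤ mΩ)
    {A Q P : Matrix n n ℝ} {C : Matrix p n ℝ} {R : Matrix p p ℝ}
    {e w : Ω → EuclideanSpace ℝ n} {v : Ω → EuclideanSpace ℝ p}
    (hR : R.PosDef) (hP : P.PosSemidef) (heG : Measurable[G] e) (hwm : Measurable w)
    (hvm : Measurable v) (he : IsCenteredGaussian μ e P) (hw : IsCenteredGaussian μ w Q)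
    (hv : IsCenteredGaussian μ v R) (hFe : Indep F (MeasurableSpace.comap e inferInstance) μ)
    (hwv : w ⟂ᵢ[μ] v)
    (hGwv : Indep G (MeasurableSpace.comap (fun ω => (w ω, v ω)) inferInstance) μ) :
    IsCenteredGaussian μ (fun ω => A.toEuclideanLin (e ω) + w ω
        - (gain A C R P).toEuclideanLin (C.toEuclideanLin (e ω) + v ω)) (ric A C Q R P) ∧
      IsCenteredGaussian μ (fun ω => C.toEuclideanLin (e ω) + v ω) (C * P * Cᵀ + R) ∧
      Indep (F ⊔ MeasurableSpace.comap (fun ω => C.toEuclideanLin (e ω) + v ω) inferInstance)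
        (MeasurableSpace.comap (fun ω => A.toEuclideanLin (e ω) + w ω
        - (gain A C R P).toEuclideanLin (C.toEuclideanLin (e ω) + v ω)) inferInstance) μ := by
  set K := gain A C R P with hK
  set i : Ω → EuclideanSpace ℝ p := fun ω => C.toEuclideanLin (e ω) + v ω with hi
  set e' : Ω → EuclideanSpace ℝ n := fun ω => A.toEuclideanLin (e ω) + w ω
    - K.toEuclideanLin (i ω) with he'
  have hem : Measurable e := heG.mono hG le_rfl
  have hF : F ≤ mΩ := hFG.trans hG
  have hecG : MeasurableSpace.comap e inferInstance ≤ G := heG.comap_le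
  have h_e_wv : e ⟂ᵢ[μ] (fun ω => (w ω, v ω)) :=
    (IndepFun_iff_Indep _ _ _).2 (indep_of_indep_of_le_left hGwv hecG)
  have hew : e ⟂ᵢ[μ] w := h_e_wv.comp measurable_id measurable_fst
  have hev : e ⟂ᵢ[μ] v := h_e_wv.comp measurable_id measurable_snd
  have hjoint : HasGaussianLaw (fun ω => (e ω, (w ω, v ω))) μ :=
    h_e_wv.hasGaussianLaw he.gaussian (hwv.hasGaussianLaw hw.gaussian hv.gaussian)
  have hcm := measurable_toEuclideanLin C
  have ham := measurable_toEuclideanLin A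
  have hkm := measurable_toEuclideanLin K
  have him : Measurable i := (hcm.comp hem).add hvm
  have he'm : Measurable e' := ((ham.comp hem).add hwm).sub (hkm.comp him)
  -- New error and innovation are a linear image of the jointly Gaussian triple (e, w, v); joint
  -- normality, not just that of each component, is what the independence below needs.
  have hpair : HasGaussianLaw (fun ω => (e' ω, i ω)) μ := by
    let fe := ContinuousLinearMap.fst ℝ (EuclideanSpace ℝ n)
      (EuclideanSpace ℝ n × EuclideanSpace ℝ p)
    let fs := ContinuousLinearMap.snd ℝ (EuclideanSpace ℝ n)
      (EuclideanSpace ℝ n × EuclideanSpace ℝ p)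
    let fw := (ContinuousLinearMap.fst ℝ (EuclideanSpace ℝ n) (EuclideanSpace ℝ p)).comp fs
    let fv := (ContinuousLinearMap.snd ℝ (EuclideanSpace ℝ n) (EuclideanSpace ℝ p)).comp fs
    let fi := (matCLM C).comp fe + fv
    exact hjoint.map_fun (((matCLM A).comp fe + fw - (matCLM K).comp fi).prod fi)
  have hii : ∀ (b : EuclideanSpace ℝ p) ω, inner ℝ b (i ω)
      = inner ℝ (Cᵀ.toEuclideanLin b) (e ω) + inner ℝ (0 : EuclideanSpace ℝ n) (w ω)
        + inner ℝ b (v ω) := fun b ω => by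
    simp only [hi, inner_add_right, inner_toEuclideanLin, inner_zero_left, add_zero]
  have hie : ∀ (a : EuclideanSpace ℝ n) ω, inner ℝ a (e' ω)
      = inner ℝ ((A - K * C)ᵀ.toEuclideanLin a) (e ω) + inner ℝ a (w ω)
        + inner ℝ (-(Kᵀ.toEuclideanLin a)) (v ω) := fun a ω => by
    have h1 : K.toEuclideanLin (i ω)
        = (K * C).toEuclideanLin (e ω) + K.toEuclideanLin (v ω) := by
      rw [hi, map_add, toEuclideanLin_mul]
    simp only [he', h1, ← inner_toEuclideanLin, map_sub, LinearMap.sub_apply, inner_add_right,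
      inner_sub_right, inner_neg_left]
    ring
  have hmi : IsCenteredGaussian μ i (C * P * Cᵀ + R) := by
    refine ⟨hpair.snd, ?_, fun a b => ?_⟩
    · refine ext_inner_left ℝ fun a => ?_
      rw [← integral_inner hpair.snd.integrable, inner_zero_right]
      simp only [hi, inner_add_right, inner_toEuclideanLin]
      rw [integral_add (he.gaussian.integrable.const_inner _)
        (hv.gaussian.integrable.const_inner _), integral_inner he.gaussian.integrable,
        integral_inner hv.gaussian.integrable, he.mean, hv.mean]
      simp
    · simp only [hii]
      rw [IsCenteredGaussian.cov_linear he hw hv hew hev hwv]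
      simp [Matrix.toLpLin_apply, Matrix.add_mulVec, ← Matrix.mulVec_mulVec,
        Matrix.dotProduct_mulVec, Matrix.mulVec_transpose]
  have hme : IsCenteredGaussian μ e' (ric A C Q R P) := by
    refine ⟨hpair.fst, ?_, fun a b => ?_⟩
    · refine ext_inner_left ℝ fun a => ?_
      rw [← integral_inner hpair.fst.integrable, inner_zero_right]
      simp only [hie]
      have hInt : ∀ {q : Type} [Fintype q] {X : Ω → EuclideanSpace ℝ q} {S : Matrix q q ℝ}
          (_ : IsCenteredGaussian μ X S) (s : EuclideanSpace ℝ q),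
          Integrable (fun ω => inner ℝ s (X ω)) μ :=
        fun h s => h.gaussian.integrable.const_inner s
      have hsum : Integrable (fun ω => inner ℝ ((A - K * C)ᵀ.toEuclideanLin a) (e ω)
          + inner ℝ a (w ω)) μ := (hInt he _).add (hInt hw _)
      rw [integral_add hsum (hInt hv _), integral_add (hInt he _) (hInt hw _), integral_inner he.gaussian.integrable,
        integral_inner hw.gaussian.integrable, integral_inner hv.gaussian.integrable,
        he.mean, hw.mean, hv.mean]
      simp
    · simp only [hie]
      -- Since e' = (A - K C) e + w - K v, its covariance appears in Joseph form, which for the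
      -- Kalman gain is `ric`.
      rw [IsCenteredGaussian.cov_linear he hw hv hew hev hwv, ← josephUpdate_gain hR hP, ← hK,
        josephUpdate]
      simp only [Matrix.toLpLin_apply, Matrix.add_mulVec, ← Matrix.mulVec_mulVec,
        Matrix.dotProduct_mulVec, Matrix.mulVec_transpose, dotProduct_add, WithLp.ofLp_neg,
        Matrix.neg_vecMul, neg_dotProduct, dotProduct_neg, neg_neg, Matrix.vecMul_vecMul]
  have hind : i ⟂ᵢ[μ] e' := by
    refine IndepFun.symm (hpair.indepFun_of_covariance_inner fun a b => ?_)
    simp only [hii, hie]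
    rw [IsCenteredGaussian.cov_linear he hw hv hew hev hwv]
    -- The cross covariance of new error and innovation; its vanishing is the equation K (C P Cᵀ +
    -- R) = A P Cᵀ defining the gain.
    have hcross : (A - K * C) * P * Cᵀ - K * R = 0 := by
      have h := gain_mul_innovation (A := A) (C := C) hR hP
      rw [← hK, Matrix.mul_add] at h
      simp only [Matrix.sub_mul, ← h]
      simp only [Matrix.mul_assoc]
      abel
    have := congrArg (fun M => a.ofLp ⬝ᵥ M *ᵥ b.ofLp) hcross
    simp only [Matrix.sub_mulVec, dotProduct_sub, Matrix.zero_mulVec, dotProduct_zero] at this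
    simp only [Matrix.toLpLin_apply, WithLp.ofLp_neg, WithLp.ofLp_zero, Matrix.mulVec_zero,
      dotProduct_zero, add_zero, neg_dotProduct]
    rw [Matrix.mulVec_transpose (A - K * C), Matrix.mulVec_transpose K,
      ← Matrix.dotProduct_mulVec, ← Matrix.dotProduct_mulVec, Matrix.mulVec_mulVec,
      Matrix.mulVec_mulVec, Matrix.mulVec_mulVec, ← sub_eq_add_neg]
    exact this
  refine ⟨hme, hmi, ?_⟩
  -- `F` is independent of `e`, and `F` with `e` is independent of the fresh noise, so `F` is
  -- independent of `e` and the noise together. Both `e'` and `i` are functions of these, so the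
  -- same regrouping adds `F` to the innovation.
  have hFall : Indep F (MeasurableSpace.comap e inferInstance ⊔
      MeasurableSpace.comap (fun ω => (w ω, v ω)) inferInstance) μ :=
    indep_sup_of_indep_sup hF hem.comap_le (hwm.prodMk hvm).comap_le hFe
      (indep_of_indep_of_le_left hGwv (sup_le hFG hecG))
  set H := MeasurableSpace.comap e inferInstance ⊔
      MeasurableSpace.comap (fun ω => (w ω, v ω)) inferInstance with hH
  have eH : Measurable[H] e := (comap_measurable e).mono le_sup_left le_rfl
  have wvH : Measurable[H] (fun ω => (w ω, v ω)) :=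
    (comap_measurable (fun ω => (w ω, v ω))).mono le_sup_right le_rfl
  have iH : Measurable[H] i := (hcm.comp eH).add (measurable_snd.comp wvH)
  have e'H : Measurable[H] e' :=
    ((ham.comp eH).add (measurable_fst.comp wvH)).sub (hkm.comp iH)
  have hind' := (IndepFun_iff_Indep _ _ _).1 hind.symm
  rw [sup_comm]
  refine (indep_sup_of_indep_sup he'm.comap_le him.comap_le hF hind' ?_).symm
  exact (indep_of_indep_of_le_right hFall (sup_le e'H.comap_le iH.comap_le)).symm

end FilterStep

/-! ### Linear images and mean square norms -/

section SecondMoments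

variable {Ω : Type*} [mΩ : MeasurableSpace Ω] {μ : Measure Ω}
variable {n p : Type} [Fintype n] [DecidableEq n] [Fintype p] [DecidableEq p]

lemma IsCenteredGaussian.map {X : Ω → EuclideanSpace ℝ n} {S : Matrix n n ℝ}
    (h : IsCenteredGaussian μ X S) (M : Matrix p n ℝ) :
    IsCenteredGaussian μ (fun ω => M.toEuclideanLin (X ω)) (M * S * Mᵀ) := by
  refine ⟨h.gaussian.map_fun (matCLM M), ?_, fun a b => ?_⟩
  · have := (matCLM M).integral_comp_comm h.gaussian.integrable
    simpa [h.mean] using this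
  · simp_rw [inner_toEuclideanLin]
    rw [h.cov]
    simp only [Matrix.toLpLin_apply]
    rw [Matrix.mulVec_transpose, ← Matrix.dotProduct_mulVec, Matrix.mulVec_mulVec,
      Matrix.mulVec_mulVec, Matrix.mul_assoc]

/-- Turns convergence of covariance matrices into mean square convergence of vectors. -/
lemma IsCenteredGaussian.lintegral_enorm_sq [IsProbabilityMeasure μ]
    {X : Ω → EuclideanSpace ℝ n} {S : Matrix n n ℝ} (h : IsCenteredGaussian μ X S) :
    ∫⁻ ω, ‖X ω‖ₑ ^ 2 ∂μ = ENNReal.ofReal S.trace := by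
  have hn : ∀ ω, ‖X ω‖ₑ ^ 2 = ENNReal.ofReal (‖X ω‖ ^ 2) := fun ω => by
    rw [ENNReal.ofReal_pow (norm_nonneg _), ofReal_norm]
  simp_rw [hn]
  rw [← ofReal_integral_eq_lintegral_ofReal h.memLp.integrable_norm_pow'
    (.of_forall fun ω => by positivity)]
  congr 1
  have hc : ∀ i, MemLp (fun ω => X ω i) 2 μ := fun i => by
    simpa [EuclideanSpace.inner_single_left] using
      h.memLp_inner (EuclideanSpace.single i (1 : ℝ))
  have hm : ∀ i, ∫ ω, X ω i ∂μ = 0 := fun i => by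
    have := integral_inner (𝕜 := ℝ) h.gaussian.integrable (EuclideanSpace.single i (1 : ℝ))
    simpa [h.mean, EuclideanSpace.inner_single_left] using this
  simp_rw [EuclideanSpace.real_norm_sq_eq]
  rw [integral_finsetSum _ fun i _ => (hc i).integrable_sq, Matrix.trace]
  refine Finset.sum_congr rfl fun i _ => ?_
  have := h.cov (EuclideanSpace.single i (1 : ℝ)) (EuclideanSpace.single i (1 : ℝ))
  simp only [EuclideanSpace.inner_single_left, map_one, one_mul] at this
  rw [covariance_eq_sub (hc i) (hc i), hm] at this
  simpa [pow_two] using this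

end SecondMoments

/-! ### The filter invariant: conditional expectation, optimality, preservation -/

section Estimation

variable {Ω : Type*} {F F' G : MeasurableSpace Ω} [mΩ : MeasurableSpace Ω] {μ : Measure Ω}
variable {n : ℕ} {p : Type} [Fintype p] [DecidableEq p]

/-- `Z` is an estimate of `X` based on the information `F` whose error is centred Gaussian with
covariance `P` and independent of `F`. -/
structure IsFilter {Ω : Type*} (F : MeasurableSpace Ω) [mΩ : MeasurableSpace Ω]
    (μ : Measure Ω) (X Z : Ω → EuclideanSpace ℝ (Fin n))
    (P : Matrix (Fin n) (Fin n) ℝ) : Prop where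
  measurable : Measurable[F] Z
  error : IsCenteredGaussian μ (fun ω => X ω - Z ω) P
  indep : Indep F (MeasurableSpace.comap (fun ω => X ω - Z ω) inferInstance) μ

namespace IsFilter

variable {X Z : Ω → EuclideanSpace ℝ (Fin n)} {P : Matrix (Fin n) (Fin n) ℝ}

/-- In X = Z + (X - Z) the first term is known from `F`, and the second is independent of `F` with
mean zero, so conditioning kills it. -/
lemma condExp_eq [IsProbabilityMeasure μ] (hF : F ≤ mΩ)
    (hX : Measurable X) (hX2 : MemLp X 2 μ) (h : IsFilter F μ X Z P) : μ[X | F] =ᵐ[μ] Z := by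
  have hXi : Integrable X μ := hX2.integrable (by norm_num)
  have hei : Integrable (fun ω => X ω - Z ω) μ := h.error.gaussian.integrable
  have hZi : Integrable Z μ := by
    have := hXi.sub hei
    refine this.congr (.of_forall fun ω => ?_)
    simp
  have hZm : Measurable Z := h.measurable.mono hF le_rfl
  have h1 : μ[X | F] =ᵐ[μ] μ[Z | F] + μ[fun ω => X ω - Z ω | F] := by
    refine (condExp_congr_ae (.of_forall fun ω => ?_)).trans (condExp_add hZi hei F)
    simp
  have h2 : μ[fun ω => X ω - Z ω | F] =ᵐ[μ] fun _ => 0 := by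
    have := condExp_indep_eq (hX.sub hZm).comap_le hF
      (comap_measurable (fun ω => X ω - Z ω)).stronglyMeasurable h.indep.symm
    rw [h.error.mean] at this
    exact this
  have h3 : μ[Z | F] = Z := condExp_of_stronglyMeasurable hF h.measurable.stronglyMeasurable hZi
  rw [h3] at h1
  filter_upwards [h1, h2] with ω e1 e2
  simp [e1, e2]

/-- Orthogonality: a competitor `W` differs from `Z` by an `F`-measurable vector, independent of the
centred error, so the cross term vanishes. The version `Z'` is allowed because the predictor of
interest is built from a conditional expectation that agrees with the recursive filter only almost
everywhere. -/
lemma isMMSEPredictor [IsProbabilityMeasure μ] (hF : F ≤ mΩ) (hX : Measurable X)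
    (h : IsFilter F μ X Z P) {Z' : Ω → EuclideanSpace ℝ (Fin n)}
    (hZ' : Measurable[F] Z') (hZZ' : Z' =ᵐ[μ] Z) : IsMMSEPredictor μ F X Z' := by
  refine ⟨hZ', fun W hW => ?_⟩
  have hZm : Measurable Z := h.measurable.mono hF le_rfl
  have hWm : Measurable W := hW.mono hF le_rfl
  have e0 : ∫⁻ ω, ‖X ω - Z' ω‖ₑ ^ 2 ∂μ = ∫⁻ ω, ‖X ω - Z ω‖ₑ ^ 2 ∂μ :=
    lintegral_congr_ae (hZZ'.mono fun ω hω => by simp [hω])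
  rw [e0]
  -- Competitors need not be square integrable; one with infinite error is trivially no better, and
  -- otherwise `D` is square integrable as a difference of two errors.
  rcases eq_or_ne (∫⁻ ω, ‖X ω - W ω‖ₑ ^ 2 ∂μ) ∞ with htop | htop
  · rw [htop]; exact le_top
  set e : Ω → EuclideanSpace ℝ (Fin n) := fun ω => X ω - Z ω with he
  set D : Ω → EuclideanSpace ℝ (Fin n) := fun ω => Z ω - W ω with hD
  have hXW : MemLp (fun ω => X ω - W ω) 2 μ := by
    refine ⟨(hX.sub hWm).aestronglyMeasurable, ?_⟩
    rw [eLpNorm_lt_top_iff_lintegral_rpow_enorm_lt_top (by norm_num) (by norm_num)]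
    simpa using htop.lt_top
  have he2 : MemLp e 2 μ := h.error.memLp
  have hD2 : MemLp D 2 μ := by
    refine (hXW.sub he2).ae_eq (.of_forall fun ω => ?_)
    simp [hD, he]
  have hDF : Measurable[F] D := h.measurable.sub hW
  have hcoord : ∀ {V : Ω → EuclideanSpace ℝ (Fin n)}, MemLp V 2 μ → ∀ i,
      MemLp (fun ω => V ω i) 2 μ := fun hV i => by
    simpa [EuclideanSpace.inner_single_left] using
      hV.const_inner (𝕜 := ℝ) (EuclideanSpace.single i (1 : ℝ))
  have hint : ∀ i, Integrable (fun ω => inner ℝ (e ω i) (D ω i)) μ := fun i => by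
    have := (hcoord he2 i).integrable_mul (hcoord hD2 i)
    refine this.congr (.of_forall fun ω => ?_)
    simp [mul_comm]
  have hcross : ∫ ω, inner ℝ (e ω) (D ω) ∂μ = 0 := by
    simp only [PiLp.inner_apply]
    rw [integral_finsetSum _ fun i _ => hint i]
    · refine Finset.sum_eq_zero fun i _ => ?_
      have hi : (fun ω => D ω i) ⟂ᵢ[μ] (fun ω => e ω i) := by
        have : D ⟂ᵢ[μ] e :=
          (IndepFun_iff_Indep _ _ _).2 (indep_of_indep_of_le_left h.indep hDF.comap_le)
        exact this.comp (φ := fun x => x i) (ψ := fun x => x i) (by fun_prop) (by fun_prop)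
      have hm : ∫ ω, e ω i ∂μ = 0 := by
        have := integral_inner (𝕜 := ℝ) h.error.gaussian.integrable (EuclideanSpace.single i (1 : ℝ))
        rw [h.error.mean] at this
        simpa [EuclideanSpace.inner_single_left, he] using this
      have := hi.integral_fun_mul_eq_mul_integral (hcoord hD2 i).aestronglyMeasurable
        (hcoord he2 i).aestronglyMeasurable
      simpa [hm] using this
  have hsq : ∀ {V : Ω → EuclideanSpace ℝ (Fin n)}, MemLp V 2 μ →
      ∫⁻ ω, ‖V ω‖ₑ ^ 2 ∂μ = ENNReal.ofReal (∫ ω, ‖V ω‖ ^ 2 ∂μ) := fun {V} hV => by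
    rw [ofReal_integral_eq_lintegral_ofReal hV.integrable_norm_pow'
      (.of_forall fun ω => by positivity)]
    refine lintegral_congr fun ω => ?_
    rw [ENNReal.ofReal_pow (norm_nonneg _), ofReal_norm]
  rw [hsq he2, hsq hXW]
  refine ENNReal.ofReal_le_ofReal ?_
  have hexp : ∀ ω, ‖X ω - W ω‖ ^ 2 = ‖e ω‖ ^ 2 + 2 * inner ℝ (e ω) (D ω) + ‖D ω‖ ^ 2 := fun ω => by
    rw [← norm_add_sq_real]
    simp [he, hD]
  simp_rw [hexp]
  have i1 : Integrable (fun ω => ‖e ω‖ ^ 2) μ := he2.integrable_norm_pow'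
  have i2 : Integrable (fun ω => 2 * inner ℝ (e ω) (D ω)) μ :=
    Integrable.const_mul (by
      simp only [PiLp.inner_apply]
      exact integrable_finsetSum _ fun i _ => hint i) 2
  have i12 : Integrable (fun ω => ‖e ω‖ ^ 2 + 2 * inner ℝ (e ω) (D ω)) μ := i1.add i2
  rw [integral_add i12 hD2.integrable_norm_pow', integral_add i1 i2,
    integral_const_mul, hcross]
  have : 0 ≤ ∫ ω, ‖D ω‖ ^ 2 ∂μ := integral_nonneg fun ω => by positivity
  linarith

/-- The Kalman recursion preserves the filter property. -/
theorem step [IsProbabilityMeasure μ] (hFG : F ≤ G) (hG : G ≤ mΩ)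
    {A Q : Matrix (Fin n) (Fin n) ℝ} {C : Matrix p (Fin n) ℝ} {R : Matrix p p ℝ}
    {w X' : Ω → EuclideanSpace ℝ (Fin n)} {v Y : Ω → EuclideanSpace ℝ p}
    (hR : R.PosDef) (hP : P.PosSemidef) (hXG : Measurable[G] X) (hwm : Measurable w)
    (hvm : Measurable v) (hw : IsCenteredGaussian μ w Q) (hv : IsCenteredGaussian μ v R)
    (hwv : w ⟂ᵢ[μ] v)
    (hGwv : Indep G (MeasurableSpace.comap (fun ω => (w ω, v ω)) inferInstance) μ)
    (hX' : ∀ ω, X' ω = A.toEuclideanLin (X ω) + w ω)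
    (hY : ∀ ω, Y ω = C.toEuclideanLin (X ω) + v ω)
    (hFF' : F ≤ F') (hYF' : Measurable[F'] Y)
    (hF' : ∀ H : MeasurableSpace Ω, F ≤ H → Measurable[H] Y → F' ≤ H)
    (h : IsFilter F μ X Z P) :
    IsFilter F' μ X' (fun ω => A.toEuclideanLin (Z ω)
        + (gain A C R P).toEuclideanLin (Y ω - C.toEuclideanLin (Z ω))) (ric A C Q R P) ∧
      IsCenteredGaussian μ (fun ω => Y ω - C.toEuclideanLin (Z ω)) (C * P * Cᵀ + R) := by
  have hZG : Measurable[G] Z := h.measurable.mono hFG le_rfl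
  obtain ⟨h1, h2, h3⟩ := filter_step (A := A) (Q := Q) (C := C) hFG hG hR hP
    (hXG.sub hZG) hwm hvm h.error hw hv h.indep hwv hGwv
  simp only [Pi.sub_apply] at h1 h2 h3
  have hinn : (fun ω => C.toEuclideanLin (X ω - Z ω) + v ω)
      = fun ω => Y ω - C.toEuclideanLin (Z ω) := by
    ext1 ω; rw [hY, map_sub]; abel
  have herr : (fun ω => A.toEuclideanLin (X ω - Z ω) + w ω
        - (gain A C R P).toEuclideanLin (C.toEuclideanLin (X ω - Z ω) + v ω))
      = fun ω => X' ω - (A.toEuclideanLin (Z ω)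
        + (gain A C R P).toEuclideanLin (Y ω - C.toEuclideanLin (Z ω))) := by
    ext1 ω
    rw [congrFun hinn ω, hX', map_sub]; abel
  rw [herr] at h1 h3
  rw [hinn] at h2 h3
  refine ⟨⟨?_, h1, indep_of_indep_of_le_left h3 (hF' _ le_sup_left ?_)⟩, h2⟩
  · have hZ' : Measurable[F'] Z := h.measurable.mono hFF' le_rfl
    exact ((measurable_toEuclideanLin A).comp hZ').add ((measurable_toEuclideanLin _).comp
      (hYF'.sub ((measurable_toEuclideanLin C).comp hZ')))
  -- Given `F`, the innovation and the output carry the same information, since Y is the innovation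
  -- plus C Z and Z is `F`-measurable.
  · have hI := (comap_measurable (m := inferInstance) (fun ω => Y ω - C.toEuclideanLin (Z ω))).mono
      (le_sup_right (a := F)) le_rfl
    have hs := hI.add ((measurable_toEuclideanLin C).comp (h.measurable.mono le_sup_left le_rfl))
    convert hs using 1
    ext1 ω; simp

end IsFilter

end Estimation

/-! ### The linear Gaussian system: centralized filter, delayed predictor, steady-state gap -/

section System

variable {n m m' : ℕ}

/-- The sources of randomness that have acted before the outputs of time `k` are produced. -/
def Source.before (k : ℕ) : Set Source :=
  {i | match i with
    | .init => True
    | .process j => j < k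
    | .loc j => j < k
    | .ext j => j < k}

lemma Source.before_mono {j k : ℕ} (h : j ≤ k) : Source.before j ⊆ Source.before k := by
  rintro (_ | i | i | i) hi
  · trivial
  all_goals exact lt_of_lt_of_le hi h

/-- The stacking map of the two outputs is measurable. -/
lemma measurable_stackY : Measurable
    (fun x : EuclideanSpace ℝ (Fin m) × EuclideanSpace ℝ (Fin m') => stackY x.1 x.2) := by
  refine (WithLp.measurable_toLp 2 _).comp (measurable_pi_iff.2 fun i => ?_)
  rcases i with i | i
  · exact (measurable_pi_apply i).comp ((WithLp.measurable_ofLp 2 _).comp measurable_fst)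
  · exact (measurable_pi_apply i).comp ((WithLp.measurable_ofLp 2 _).comp measurable_snd)

lemma measurable_unstackY_left : Measurable
    (fun x : EuclideanSpace ℝ (Fin m ⊕ Fin m') =>
      (WithLp.toLp 2 fun i => x (Sum.inl i) : EuclideanSpace ℝ (Fin m))) :=
  (WithLp.measurable_toLp 2 _).comp (measurable_pi_iff.2 fun i =>
    (measurable_pi_apply (Sum.inl i)).comp (WithLp.measurable_ofLp 2 _))

lemma measurable_unstackY_right : Measurable
    (fun x : EuclideanSpace ℝ (Fin m ⊕ Fin m') =>
      (WithLp.toLp 2 fun i => x (Sum.inr i) : EuclideanSpace ℝ (Fin m'))) :=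
  (WithLp.measurable_toLp 2 _).comp (measurable_pi_iff.2 fun i =>
    (measurable_pi_apply (Sum.inr i)).comp (WithLp.measurable_ofLp 2 _))

/-- Exhibits the stacked outputs as an instance of the single-output model, so one filter step
serves both the centralized and the local case. -/
lemma stackY_add (C : Matrix (Fin m) (Fin n) ℝ) (Ce : Matrix (Fin m') (Fin n) ℝ)
    (x : EuclideanSpace ℝ (Fin n)) (v : EuclideanSpace ℝ (Fin m)) (ve : EuclideanSpace ℝ (Fin m')) :
    stackY (C.toEuclideanLin x + v) (Ce.toEuclideanLin x + ve)
      = (stackC C Ce).toEuclideanLin x + stackY v ve := by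
  ext i
  rcases i with i | i <;> simp [stackY, stackC, Matrix.toLpLin_apply, Matrix.mulVec]

variable {Ω : Type*}

lemma measurable_info_local {y : ℕ → Ω → EuclideanSpace ℝ (Fin m)}
    {ye : ℕ → Ω → EuclideanSpace ℝ (Fin m')} {a b i : ℕ} (h : i < a) :
    Measurable[info y ye a b] (y i) :=
  measurable_iff_comap_le.2 ((le_biSup (fun i => MeasurableSpace.comap (y i) inferInstance)
    (Finset.mem_range.2 h)).trans le_sup_left)

lemma measurable_info_external {y : ℕ → Ω → EuclideanSpace ℝ (Fin m)}
    {ye : ℕ → Ω → EuclideanSpace ℝ (Fin m')} {a b i : ℕ} (h : i < b) :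
    Measurable[info y ye a b] (ye i) :=
  measurable_iff_comap_le.2 ((le_biSup (fun i => MeasurableSpace.comap (ye i) inferInstance)
    (Finset.mem_range.2 h)).trans le_sup_right)

lemma info_le {y : ℕ → Ω → EuclideanSpace ℝ (Fin m)}
    {ye : ℕ → Ω → EuclideanSpace ℝ (Fin m')} {a b : ℕ} {H : MeasurableSpace Ω}
    (hy : ∀ i < a, Measurable[H] (y i)) (hye : ∀ i < b, Measurable[H] (ye i)) :
    info y ye a b ≤ H :=
  sup_le (iSup₂_le fun i hi => (hy i (Finset.mem_range.1 hi)).comap_le)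
    (iSup₂_le fun i hi => (hye i (Finset.mem_range.1 hi)).comap_le)

lemma info_mono {y : ℕ → Ω → EuclideanSpace ℝ (Fin m)}
    {ye : ℕ → Ω → EuclideanSpace ℝ (Fin m')} {a a' b b' : ℕ} (ha : a ≤ a') (hb : b ≤ b') :
    info y ye a b ≤ info y ye a' b' :=
  info_le (fun _ hi => measurable_info_local (hi.trans_le ha))
    (fun _ hi => measurable_info_external (hi.trans_le hb))

/-- The centralized Kalman filter started at `x₀`, with error covariances `Pk`. -/
noncomputable def centralFilter (A : Matrix (Fin n) (Fin n) ℝ) (C : Matrix (Fin m) (Fin n) ℝ)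
    (Ce : Matrix (Fin m') (Fin n) ℝ) (R : Matrix (Fin m) (Fin m) ℝ)
    (Re : Matrix (Fin m') (Fin m') ℝ) (Pk : ℕ → Matrix (Fin n) (Fin n) ℝ)
    (x₀ : EuclideanSpace ℝ (Fin n)) (y : ℕ → Ω → EuclideanSpace ℝ (Fin m))
    (ye : ℕ → Ω → EuclideanSpace ℝ (Fin m')) : ℕ → Ω → EuclideanSpace ℝ (Fin n)
  | 0 => fun _ => x₀
  | k + 1 => fun ω => A.toEuclideanLin (centralFilter A C Ce R Re Pk x₀ y ye k ω)
      + (gain A (stackC C Ce) (diagR R Re) (Pk k)).toEuclideanLin (stackY (y k ω) (ye k ω)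
        - (stackC C Ce).toEuclideanLin (centralFilter A C Ce R Re Pk x₀ y ye k ω))

variable [mΩ : MeasurableSpace Ω] {μ : Measure Ω}
  {A : Matrix (Fin n) (Fin n) ℝ} {C : Matrix (Fin m) (Fin n) ℝ} {Ce : Matrix (Fin m') (Fin n) ℝ}
  {Q : Matrix (Fin n) (Fin n) ℝ} {R : Matrix (Fin m) (Fin m) ℝ} {Re : Matrix (Fin m') (Fin m') ℝ}
  {x₀ : EuclideanSpace ℝ (Fin n)} {S₀ : Matrix (Fin n) (Fin n) ℝ}
  {x w : ℕ → Ω → EuclideanSpace ℝ (Fin n)} {y v : ℕ → Ω → EuclideanSpace ℝ (Fin m)}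
  {ye ve : ℕ → Ω → EuclideanSpace ℝ (Fin m')}

/-- The `σ`-algebra generated by a set of sources of randomness. -/
abbrev sourceInfo (x0 : Ω → EuclideanSpace ℝ (Fin n))
    (w : ℕ → Ω → EuclideanSpace ℝ (Fin n)) (v : ℕ → Ω → EuclideanSpace ℝ (Fin m))
    (ve : ℕ → Ω → EuclideanSpace ℝ (Fin m')) (S : Set Source) : MeasurableSpace Ω :=
  ⨆ i ∈ S, MeasurableSpace.comap (sourceFamily x0 w v ve i) inferInstance

lemma measurable_sourceInfo {x0 : Ω → EuclideanSpace ℝ (Fin n)} {S : Set Source} {i : Source}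
    (h : i ∈ S) : Measurable[sourceInfo x0 w v ve S] (sourceFamily x0 w v ve i) :=
  measurable_iff_comap_le.2
    (le_biSup (fun i => MeasurableSpace.comap (sourceFamily x0 w v ve i) inferInstance) h)

lemma sourceInfo_mono {x0 : Ω → EuclideanSpace ℝ (Fin n)} {S T : Set Source} (h : S ⊆ T) :
    sourceInfo x0 w v ve S ≤ sourceInfo x0 w v ve T :=
  biSup_mono fun _ hi => h hi

namespace IsLinearGaussianSystem

variable (hs : IsLinearGaussianSystem μ A C Ce Q R Re x₀ S₀ x w y v ye ve)

include hs

lemma measurable_source (i : Source) : Measurable (sourceFamily (x 0) w v ve i) := by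
  rcases i with _ | k | k | k
  · exact hs.measurable_init
  · exact hs.measurable_process k
  · exact hs.measurable_local k
  · exact hs.measurable_external k

lemma sourceInfo_le (S : Set Source) : sourceInfo (x 0) w v ve S ≤ mΩ :=
  iSup₂_le fun i _ => (hs.measurable_source i).comap_le

lemma indep_sourceInfo {S T : Set Source} (h : Disjoint S T) :
    Indep (sourceInfo (x 0) w v ve S) (sourceInfo (x 0) w v ve T) μ :=
  indep_iSup_of_disjoint (fun i => (hs.measurable_source i).comap_le) hs.indep h

lemma measurable_state (k : ℕ) : Measurable[sourceInfo (x 0) w v ve (Source.before k)] (x k) := by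
  induction k with
  | zero => exact measurable_sourceInfo (i := .init) trivial
  | succ k ih =>
    have e : x (k + 1) = fun ω => A.toEuclideanLin (x k ω) + w k ω :=
      funext fun ω => hs.state_eq k ω
    rw [e]
    have hle := sourceInfo_mono (x0 := x 0) (w := w) (v := v) (ve := ve)
      (Source.before_mono k.le_succ)
    have hw := measurable_sourceInfo (x0 := x 0) (w := w) (v := v) (ve := ve)
      (S := Source.before (k + 1)) (i := .process k) k.lt_succ_self
    exact ((measurable_toEuclideanLin A).comp (ih.mono hle le_rfl)).add hw

lemma measurable_output {j k : ℕ} (h : j < k) :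
    Measurable[sourceInfo (x 0) w v ve (Source.before k)] (y j) := by
  have e : y j = fun ω => C.toEuclideanLin (x j ω) + v j ω := funext fun ω => hs.output_eq j ω
  rw [e]
  have hle := sourceInfo_mono (x0 := x 0) (w := w) (v := v) (ve := ve)
    (Source.before_mono h.le)
  have hv := measurable_sourceInfo (x0 := x 0) (w := w) (v := v) (ve := ve)
    (S := Source.before k) (i := .loc j) h
  exact ((measurable_toEuclideanLin C).comp ((hs.measurable_state j).mono hle le_rfl)).add hv

lemma measurable_externalOutput {j k : ℕ} (h : j < k) :
    Measurable[sourceInfo (x 0) w v ve (Source.before k)] (ye j) := by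
  have e : ye j = fun ω => Ce.toEuclideanLin (x j ω) + ve j ω :=
    funext fun ω => hs.external_eq j ω
  rw [e]
  have hle := sourceInfo_mono (x0 := x 0) (w := w) (v := v) (ve := ve)
    (Source.before_mono h.le)
  have hv := measurable_sourceInfo (x0 := x 0) (w := w) (v := v) (ve := ve)
    (S := Source.before k) (i := .ext j) h
  exact ((measurable_toEuclideanLin Ce).comp ((hs.measurable_state j).mono hle le_rfl)).add hv

lemma info_le_sourceInfo {a b k : ℕ} (ha : a ≤ k) (hb : b ≤ k) :
    info y ye a b ≤ sourceInfo (x 0) w v ve (Source.before k) :=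
  info_le (fun _ hi => hs.measurable_output (hi.trans_le ha))
    (fun _ hi => hs.measurable_externalOutput (hi.trans_le hb))

lemma info_le_ambient (a b : ℕ) : info y ye a b ≤ mΩ :=
  (hs.info_le_sourceInfo (le_max_left a b) (le_max_right a b)).trans (hs.sourceInfo_le _)

lemma measurable_state_ambient (k : ℕ) : Measurable (x k) :=
  (hs.measurable_state k).mono (hs.sourceInfo_le _) le_rfl

lemma memLp_state [IsProbabilityMeasure μ] (hQ : Q.PosDef) (k : ℕ) : MemLp (x k) 2 μ := by
  induction k with
  | zero =>
    have hg : HasGaussianLaw (x 0) μ := ⟨by rw [hs.law_init]; infer_instance⟩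
    exact hg.memLp_two
  | succ k ih =>
    have e : x (k + 1) = fun ω => A.toEuclideanLin (x k ω) + w k ω :=
      funext fun ω => hs.state_eq k ω
    rw [e]
    exact ((matCLM A).comp_memLp' ih).add (IsCenteredGaussian.of_law_zero
      (hs.measurable_process k) hQ.posSemidef (hs.law_process k)).memLp

lemma measurable_stackNoise (k : ℕ) : Measurable (fun ω => stackY (v k ω) (ve k ω)) :=
  measurable_stackY.comp ((hs.measurable_local k).prodMk (hs.measurable_external k))

lemma indepFun_process_stack (k : ℕ) : w k ⟂ᵢ[μ] (fun ω => stackY (v k ω) (ve k ω)) := by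
  have h := hs.indep_sourceInfo (S := {.process k}) (T := {.loc k, .ext k}) (by simp)
  have hw := measurable_sourceInfo (x0 := x 0) (w := w) (v := v) (ve := ve)
    (S := {.process k}) (i := .process k) rfl
  have hv := measurable_sourceInfo (x0 := x 0) (w := w) (v := v) (ve := ve)
    (S := {.loc k, .ext k}) (i := .loc k) (by simp)
  have hve := measurable_sourceInfo (x0 := x 0) (w := w) (v := v) (ve := ve)
    (S := {.loc k, .ext k}) (i := .ext k) (by simp)
  have hst := measurable_stackY.comp (hv.prodMk hve)
  exact (IndepFun_iff_Indep _ _ _).2 (indep_of_indep_of_le h hw.comap_le hst.comap_le)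

lemma indepFun_local_external (k : ℕ) : v k ⟂ᵢ[μ] ve k :=
  hs.indep.indepFun (i := .loc k) (j := .ext k) (by simp)

lemma indepFun_process_local (k : ℕ) : w k ⟂ᵢ[μ] v k :=
  hs.indep.indepFun (i := .process k) (j := .loc k) (by simp)

/-- The past means all sources acting before time `k`, not just the outputs, because the prediction
error involves the state x_k. -/
lemma indep_past_noise (k : ℕ) : Indep (sourceInfo (x 0) w v ve (Source.before k))
    (MeasurableSpace.comap (fun ω => (w k ω, stackY (v k ω) (ve k ω))) inferInstance) μ := by
  have hd : Disjoint (Source.before k) {.process k, .loc k, .ext k} := by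
    refine Set.disjoint_left.2 fun i hi hT => ?_
    rcases hT with rfl | rfl | rfl <;> exact lt_irrefl k hi
  have h := hs.indep_sourceInfo hd
  have hw := measurable_sourceInfo (x0 := x 0) (w := w) (v := v) (ve := ve)
    (S := {.process k, .loc k, .ext k}) (i := .process k) (by simp)
  have hv := measurable_sourceInfo (x0 := x 0) (w := w) (v := v) (ve := ve)
    (S := {.process k, .loc k, .ext k}) (i := .loc k) (by simp)
  have hve := measurable_sourceInfo (x0 := x 0) (w := w) (v := v) (ve := ve)
    (S := {.process k, .loc k, .ext k}) (i := .ext k) (by simp)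
  exact indep_of_indep_of_le_right h (hw.prodMk (measurable_stackY.comp (hv.prodMk hve))).comap_le

lemma indep_past_localNoise (k : ℕ) : Indep (sourceInfo (x 0) w v ve (Source.before k))
    (MeasurableSpace.comap (fun ω => (w k ω, v k ω)) inferInstance) μ := by
  have hd : Disjoint (Source.before k) {.process k, .loc k} := by
    refine Set.disjoint_left.2 fun i hi hT => ?_
    rcases hT with rfl | rfl <;> exact lt_irrefl k hi
  have h := hs.indep_sourceInfo hd
  have hw := measurable_sourceInfo (x0 := x 0) (w := w) (v := v) (ve := ve)
    (S := {.process k, .loc k}) (i := .process k) (by simp)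
  have hv := measurable_sourceInfo (x0 := x 0) (w := w) (v := v) (ve := ve)
    (S := {.process k, .loc k}) (i := .loc k) (by simp)
  exact indep_of_indep_of_le_right h (hw.prodMk hv).comap_le

/-- The centralized Kalman filter is a filter for the centralized information. -/
theorem isFilter_central [IsProbabilityMeasure μ] (hQ : Q.PosDef) (hR : R.PosDef)
    (hRe : Re.PosDef) (hS₀ : S₀.PosSemidef) (k : ℕ) :
    IsFilter (info y ye k k) μ (x k)
      (centralFilter A C Ce R Re (fun k => (ric A (stackC C Ce) Q (diagR R Re))^[k] S₀) x₀ y ye k)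
      ((ric A (stackC C Ce) Q (diagR R Re))^[k] S₀) := by
  induction k with
  | zero =>
    refine ⟨measurable_const, IsCenteredGaussian.of_law hs.measurable_init hS₀ hs.law_init, ?_⟩
    have : info y ye 0 0 = ⊥ := by simp [info]
    rw [this]
    exact indep_bot_left _
  | succ k ih =>
    rw [Function.iterate_succ_apply']
    have hw := IsCenteredGaussian.of_law_zero (hs.measurable_process k) hQ.posSemidef
      (hs.law_process k)
    have hv := (IsCenteredGaussian.of_law_zero (hs.measurable_local k) hR.posSemidef
      (hs.law_local k)).stack (IsCenteredGaussian.of_law_zero (hs.measurable_external k)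
      hRe.posSemidef (hs.law_external k)) (hs.indepFun_local_external k)
    refine (IsFilter.step (F' := info y ye (k + 1) (k + 1))
      (Y := fun ω => stackY (y k ω) (ye k ω)) (hs.info_le_sourceInfo le_rfl le_rfl)
      (hs.sourceInfo_le _) (diagR_posDef hR hRe)
      (ric_iterate_posSemidef hQ.posSemidef (diagR_posDef hR hRe) hS₀ k) (hs.measurable_state k)
      (hs.measurable_process k) (hs.measurable_stackNoise k) hw hv (hs.indepFun_process_stack k)
      (hs.indep_past_noise k) (hs.state_eq k) (fun ω => ?_) (info_mono k.le_succ k.le_succ)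
      (measurable_stackY.comp ((measurable_info_local k.lt_succ_self).prodMk
        (measurable_info_external k.lt_succ_self))) (fun H hH hYH => ?_) ih).1
    · simp only [hs.output_eq, hs.external_eq, stackY_add]
    -- The new information is the least one containing the old and the stacked output, since both
    -- outputs are recovered by projecting the stack.
    · refine info_le (fun i hi => ?_) fun i hi => ?_
      · rcases (Nat.lt_succ_iff_lt_or_eq.1 hi) with h | rfl
        · exact (measurable_info_local h).mono hH le_rfl
        · exact measurable_unstackY_left.comp hYH
      · rcases (Nat.lt_succ_iff_lt_or_eq.1 hi) with h | rfl
        · exact (measurable_info_external h).mono hH le_rfl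
        · exact measurable_unstackY_right.comp hYH

/-- One local step, with the external outputs frozen. -/
lemma isFilter_local_step [IsProbabilityMeasure μ] (hQ : Q.PosDef) (hR : R.PosDef)
    {k b : ℕ} (hb : b ≤ k) {Z : Ω → EuclideanSpace ℝ (Fin n)} {P : Matrix (Fin n) (Fin n) ℝ}
    (hP : P.PosSemidef) (h : IsFilter (info y ye k b) μ (x k) Z P) :
    IsFilter (info y ye (k + 1) b) μ (x (k + 1)) (fun ω => A.toEuclideanLin (Z ω)
        + (gain A C R P).toEuclideanLin (y k ω - C.toEuclideanLin (Z ω))) (ric A C Q R P) ∧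
      IsCenteredGaussian μ (fun ω => y k ω - C.toEuclideanLin (Z ω)) (C * P * Cᵀ + R) := by
  have hw := IsCenteredGaussian.of_law_zero (hs.measurable_process k) hQ.posSemidef
    (hs.law_process k)
  have hv := IsCenteredGaussian.of_law_zero (hs.measurable_local k) hR.posSemidef
    (hs.law_local k)
  refine IsFilter.step (F' := info y ye (k + 1) b) (hs.info_le_sourceInfo le_rfl hb)
    (hs.sourceInfo_le _) hR hP (hs.measurable_state k)
    (hs.measurable_process k) (hs.measurable_local k) hw hv (hs.indepFun_process_local k)
    (hs.indep_past_localNoise k) (hs.state_eq k) (hs.output_eq k) (info_mono k.le_succ le_rfl)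
    (measurable_info_local k.lt_succ_self) (fun H hH hYH => ?_) h
  refine info_le (fun i hi => ?_) fun i hi => (measurable_info_external hi).mono hH le_rfl
  rcases (Nat.lt_succ_iff_lt_or_eq.1 hi) with h | rfl
  · exact (measurable_info_local h).mono hH le_rfl
  · exact hYH

/-- The delayed predictor started from a filter at time `t + 1` is a filter. -/
theorem isFilter_delayed [IsProbabilityMeasure μ] (hQ : Q.PosDef) (hR : R.PosDef)
    {t : ℕ} {Z : Ω → EuclideanSpace ℝ (Fin n)} {P : Matrix (Fin n) (Fin n) ℝ}
    (hP : P.PosSemidef) (h : IsFilter (info y ye (t + 1) (t + 1)) μ (x (t + 1)) Z P) (d : ℕ) :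
    IsFilter (info y ye (d + t + 1) (t + 1)) μ (x (d + t + 1))
      (fun ω => delayedPredictor A C Q R P d (d + t) (Z ω) (fun i => y i ω))
      (localCov A C Q R P (d + 1)) := by
  induction d with
  -- Delay 0 carries the covariance P^(1) = P, which is why the index of `localCov` is `d + 1`.
  | zero => simpa [delayedPredictor_zero, localCov] using h
  | succ d ih =>
    have := (hs.isFilter_local_step hQ hR (by omega) (localCov_posSemidef hQ hR hP _) ih).1
    simp only [delayedPredictor_succ]
    have e1 : d + 1 + t + 1 = d + t + 1 + 1 := by omega
    have e2 : t + (d + 1) = d + t + 1 := by omega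
    have e3 : localCov A C Q R P (d + 1 + 1) = ric A C Q R (localCov A C Q R P (d + 1)) := by
      simp only [localCov, Nat.add_sub_cancel]
      exact Function.iterate_succ_apply' _ _ _
    rw [e1, e2, e3]
    exact this

/-- The local innovation of the delayed predictor. -/
lemma innovation_delayed [IsProbabilityMeasure μ] (hQ : Q.PosDef) (hR : R.PosDef)
    {t : ℕ} {Z : Ω → EuclideanSpace ℝ (Fin n)} {P : Matrix (Fin n) (Fin n) ℝ}
    (hP : P.PosSemidef) (h : IsFilter (info y ye (t + 1) (t + 1)) μ (x (t + 1)) Z P) (d : ℕ) :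
    IsCenteredGaussian μ (fun ω => y (t + (d + 1)) ω - C.toEuclideanLin
      (delayedPredictor A C Q R P d (d + t) (Z ω) (fun i => y i ω)))
      (C * localCov A C Q R P (d + 1) * Cᵀ + R) := by
  rw [show t + (d + 1) = d + t + 1 by omega]
  exact (hs.isFilter_local_step hQ hR (by omega) (localCov_posSemidef hQ hR hP _)
    (hs.isFilter_delayed hQ hR hP h d)).2

/-- If the initial covariances converge, the delayed predictors computed with them and with the
limit become asymptotically equal in mean square. -/
theorem tendsto_delayed_gap [IsProbabilityMeasure μ] (hQ : Q.PosDef) (hR : R.PosDef)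
    {Z : ℕ → Ω → EuclideanSpace ℝ (Fin n)} {P : ℕ → Matrix (Fin n) (Fin n) ℝ}
    {Pbar : Matrix (Fin n) (Fin n) ℝ} (hP : ∀ k, (P k).PosSemidef) (hPbar : Pbar.PosSemidef)
    (hlim : Tendsto P atTop (𝓝 Pbar))
    (h : ∀ k, IsFilter (info y ye k k) μ (x k) (Z k) (P k)) (d : ℕ) :
    Tendsto (fun t => eLpNorm (fun ω =>
      delayedPredictor A C Q R (P (t + 1)) d (d + t) (Z (t + 1) ω) (fun i => y i ω)
      - delayedPredictor A C Q R Pbar d (d + t) (Z (t + 1) ω) (fun i => y i ω)) 2 μ)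
      atTop (𝓝 0) := by
  have hlim' : Tendsto (fun t => P (t + 1)) atTop (𝓝 Pbar) := (tendsto_add_atTop_iff_nat 1).2 hlim
  induction d with
  | zero => simp [delayedPredictor_zero]
  | succ d ih =>
    set u : ℕ → Ω → EuclideanSpace ℝ (Fin n) := fun t ω =>
      delayedPredictor A C Q R (P (t + 1)) d (d + t) (Z (t + 1) ω) (fun i => y i ω) with hu
    set u' : ℕ → Ω → EuclideanSpace ℝ (Fin n) := fun t ω =>
      delayedPredictor A C Q R Pbar d (d + t) (Z (t + 1) ω) (fun i => y i ω) with hu'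
    set L' := localGain A C Q R Pbar (d + 1) with hL'
    set ι : ℕ → Ω → EuclideanSpace ℝ (Fin m) := fun t ω =>
      y (t + (d + 1)) ω - C.toEuclideanLin (u t ω) with hι
    set M : ℕ → Matrix (Fin n) (Fin m) ℝ := fun t =>
      localGain A C Q R (P (t + 1)) (d + 1) - L' with hM
    -- The gap is propagated by the fixed matrix A - L' C and driven by the gain error applied to
    -- the innovation of the exact predictor. The output itself could grow without bound when `A` is
    -- unstable, whereas this innovation has convergent covariance. No stability is required since
    -- `d` is fixed.
    have hrec : ∀ t ω, delayedPredictor A C Q R (P (t + 1)) (d + 1) (d + 1 + t) (Z (t + 1) ω)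
          (fun i => y i ω)
        - delayedPredictor A C Q R Pbar (d + 1) (d + 1 + t) (Z (t + 1) ω) (fun i => y i ω)
        = matCLM (A - L' * C) (u t ω - u' t ω) + (M t).toEuclideanLin (ι t ω) := fun t ω => by
      simp only [delayedPredictor_succ, matCLM_apply, map_sub, LinearMap.sub_apply,
        toEuclideanLin_mul, hM, hι, hu, hu', hL']
      abel
    have hinn := fun t => hs.innovation_delayed hQ hR (hP (t + 1)) (h (t + 1)) d
    have hMt : Tendsto M atTop (𝓝 0) := by
      have := (localGain_tendsto (A := A) (C := C) hQ hR hPbar hlim' (d + 1)).sub_const L'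
      simpa [hL'] using this
    set S : ℕ → Matrix (Fin m) (Fin m) ℝ := fun t =>
      C * localCov A C Q R (P (t + 1)) (d + 1) * Cᵀ + R with hS
    have hSt : Tendsto S atTop (𝓝 (C * localCov A C Q R Pbar (d + 1) * Cᵀ + R)) :=
      (tendsto_matrix_mul (tendsto_matrix_mul tendsto_const_nhds
        (localCov_tendsto hQ hR hPbar hlim' (d + 1))) tendsto_const_nhds).add_const R
    -- The mean square of the driving term is the trace of M S Mᵀ, where M tends to 0 and S
    -- converges.
    have htr : Tendsto (fun t => ENNReal.ofReal (M t * S t * (M t)ᵀ).trace) atTop (𝓝 0) := by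
      have hMT : Tendsto (fun t => (M t)ᵀ) atTop (𝓝 (0 : Matrix (Fin n) (Fin m) ℝ)ᵀ) :=
        (continuous_id.matrix_transpose.tendsto 0).comp hMt
      have h1 := tendsto_matrix_mul (tendsto_matrix_mul hMt hSt) hMT
      have h2 := ENNReal.tendsto_ofReal
        (((continuous_id (X := Matrix (Fin n) (Fin n) ℝ)).matrix_trace.tendsto _).comp h1)
      simpa using h2
    have hnorm : Tendsto (fun t => eLpNorm (fun ω => (M t).toEuclideanLin (ι t ω)) 2 μ) atTop
        (𝓝 0) := by
      have e : ∀ t, eLpNorm (fun ω => (M t).toEuclideanLin (ι t ω)) 2 μ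
          = ENNReal.ofReal (M t * S t * (M t)ᵀ).trace ^ (1 / 2 : ℝ) := fun t => by
        rw [← ((hinn t).map (M t)).lintegral_enorm_sq,
          eLpNorm_eq_lintegral_rpow_enorm_toReal (by norm_num) (by norm_num)]
        simp [hι, hu]
      simp_rw [e]
      have := (ENNReal.continuous_rpow_const (y := 1 / 2)).tendsto 0 |>.comp htr
      simpa [Function.comp_def] using this
    have hfirst : Tendsto (fun t => ‖matCLM (A - L' * C)‖ₑ
        * eLpNorm (fun ω => u t ω - u' t ω) 2 μ) atTop (𝓝 0) := by
      have := ENNReal.Tendsto.const_mul (a := ‖matCLM (A - L' * C)‖ₑ) ih (Or.inr (by simp))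
      simpa using this
    have hsum := hfirst.add hnorm
    rw [add_zero] at hsum
    refine tendsto_of_tendsto_of_tendsto_of_le_of_le tendsto_const_nhds hsum
      (fun _ => zero_le) fun t => ?_
    simp only [hrec]
    have hZm : Measurable (Z (t + 1)) :=
      (h (t + 1)).measurable.mono (hs.info_le_ambient _ _) le_rfl
    have hmeas : ∀ P' : Matrix (Fin n) (Fin n) ℝ, Measurable fun ω =>
        delayedPredictor A C Q R P' d (d + t) (Z (t + 1) ω) (fun i => y i ω) := fun P' => by
      have hy : ∀ i, Measurable (y i) := fun i =>
        (hs.measurable_output i.lt_succ_self).mono (hs.sourceInfo_le _) le_rfl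
      exact ((measurable_toEuclideanLin _).comp hZm).add
        (Finset.measurable_sum _ fun l _ => (measurable_toEuclideanLin _).comp (hy _))
    have hum : Measurable (fun ω => u t ω - u' t ω) := (hmeas _).sub (hmeas _)
    refine (eLpNorm_add_le (f := fun ω => matCLM (A - L' * C) (u t ω - u' t ω))
      ((matCLM _).continuous.measurable.comp hum).aestronglyMeasurable
      ((hinn t).map (M t)).memLp.aestronglyMeasurable (by norm_num)).trans ?_
    refine add_le_add ?_ le_rfl
    exact eLpNorm_le_mul_eLpNorm_of_ae_le_mul'' _ hum.aestronglyMeasurable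
      (.of_forall fun ω => (matCLM (A - L' * C)).le_opENorm _)

end IsLinearGaussianSystem

end System

end DelayedKalman

/-! ### Assembly of the main theorem -/

theorem proposition1 {n m m' : ℕ}
    (A : Matrix (Fin n) (Fin n) ℝ) (C : Matrix (Fin m) (Fin n) ℝ) (Ce : Matrix (Fin m') (Fin n) ℝ)
    (Q : Matrix (Fin n) (Fin n) ℝ) (R : Matrix (Fin m) (Fin m) ℝ)
    (Re : Matrix (Fin m') (Fin m') ℝ)
    (hQ : Q.PosDef) (hR : R.PosDef) (hRe : Re.PosDef)
    (hdet : DelayedKalman.Detectable A (DelayedKalman.stackC C Ce)) :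
    -- the centralized Riccati equation has a unique positive semidefinite solution
    ∃ Pbar : Matrix (Fin n) (Fin n) ℝ,
      (Pbar.PosSemidef ∧
        Pbar = DelayedKalman.ric A (DelayedKalman.stackC C Ce) Q (DelayedKalman.diagR R Re) Pbar) ∧
      (∀ P : Matrix (Fin n) (Fin n) ℝ, P.PosSemidef →
        P = DelayedKalman.ric A (DelayedKalman.stackC C Ce) Q (DelayedKalman.diagR R Re) P →
        P = Pbar) ∧
      ∀ (Ω : Type*) [MeasurableSpace Ω] (μ : Measure Ω) [IsProbabilityMeasure μ]
        (x₀ : EuclideanSpace ℝ (Fin n)) (S₀ : Matrix (Fin n) (Fin n) ℝ)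
        (x w : ℕ → Ω → EuclideanSpace ℝ (Fin n)) (y v : ℕ → Ω → EuclideanSpace ℝ (Fin m))
        (ye ve : ℕ → Ω → EuclideanSpace ℝ (Fin m')),
        S₀.PosSemidef →
        DelayedKalman.IsLinearGaussianSystem μ A C Ce Q R Re x₀ S₀ x w y v ye ve →
        -- `Pk k` is the centralized error covariance at time `k`, `xbar k` the centralized
        -- prediction
        let Pk : ℕ → Matrix (Fin n) (Fin n) ℝ := fun k =>
          (DelayedKalman.ric A (DelayedKalman.stackC C Ce) Q (DelayedKalman.diagR R Re))^[k] S₀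
        let xbar : ℕ → Ω → EuclideanSpace ℝ (Fin n) := DelayedKalman.centralPrediction μ x y ye
        -- the centralized prediction is given by the centralized Kalman filter
        (xbar 0 =ᵐ[μ] fun _ => x₀) ∧
        (∀ k, xbar (k + 1) =ᵐ[μ] fun ω =>
          A.toEuclideanLin (xbar k ω) +
            (DelayedKalman.gain A (DelayedKalman.stackC C Ce) (DelayedKalman.diagR R Re)
              (Pk k)).toEuclideanLin
              (DelayedKalman.stackY (y k ω) (ye k ω)
                - (DelayedKalman.stackC C Ce).toEuclideanLin (xbar k ω))) ∧
        -- at every time, the MMSE predictor has the stated form with `P^(1) = Pk (k - d + 1)`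
        (∀ d k, d ≤ k →
          DelayedKalman.delayedCondExp μ x y ye d k =ᵐ[μ] (fun ω =>
            DelayedKalman.delayedPredictor A C Q R (Pk (k - d + 1)) d k
              (xbar (k - d + 1) ω) (fun i => y i ω)) ∧
          DelayedKalman.IsMMSEPredictor μ (DelayedKalman.info y ye (k + 1) (k - d + 1)) (x (k + 1))
            (fun ω => DelayedKalman.delayedPredictor A C Q R (Pk (k - d + 1)) d k
              (xbar (k - d + 1) ω) (fun i => y i ω))) ∧
        -- it approaches its steady state, which is the stated form with `P^(1) = Pbar`:
        -- the covariances and all coefficients converge, and the gap vanishes in mean square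
        Tendsto Pk atTop (𝓝 Pbar) ∧
        (∀ d l, l ≤ d →
          Tendsto (fun k => DelayedKalman.Phi A C Q R (Pk k) d l) atTop
            (𝓝 (DelayedKalman.Phi A C Q R Pbar d l))) ∧
        (∀ l, 1 ≤ l →
          Tendsto (fun k => DelayedKalman.localGain A C Q R (Pk k) l) atTop
            (𝓝 (DelayedKalman.localGain A C Q R Pbar l))) ∧
        (∀ d, Tendsto (fun k => ∫⁻ ω, ‖DelayedKalman.delayedCondExp μ x y ye d k ω
            - DelayedKalman.delayedPredictor A C Q R Pbar d k
                (xbar (k - d + 1) ω) (fun i => y i ω)‖ₑ ^ 2 ∂μ) atTop (𝓝 0)) ∧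
        -- when the centralized filter starts in its steady state, the MMSE predictor is exactly
        -- the stated form with `P^(1) = Pbar`, at every time
        (S₀ = Pbar → ∀ d k, d ≤ k →
          DelayedKalman.delayedCondExp μ x y ye d k =ᵐ[μ] (fun ω =>
            DelayedKalman.delayedPredictor A C Q R Pbar d k
              (xbar (k - d + 1) ω) (fun i => y i ω)) ∧
          DelayedKalman.IsMMSEPredictor μ (DelayedKalman.info y ye (k + 1) (k - d + 1)) (x (k + 1))
            (fun ω => DelayedKalman.delayedPredictor A C Q R Pbar d k
              (xbar (k - d + 1) ω) (fun i => y i ω))) := by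
  have hRR := DelayedKalman.diagR_posDef hR hRe
  obtain ⟨Pbar, hPbar, hfix⟩ := DelayedKalman.exists_ric_fixedPoint hQ hRR hdet
  refine ⟨Pbar, ⟨hPbar, hfix⟩,
    fun P hP h => DelayedKalman.ric_fixedPoint_unique hQ hRR hP hPbar h hfix, ?_⟩
  intro Ω _ μ _ x₀ S₀ x w y v ye ve hS₀ hs Pk xbar
  have hPk : ∀ k, (Pk k).PosSemidef := fun k =>
    DelayedKalman.ric_iterate_posSemidef hQ.posSemidef hRR hS₀ k
  set z := DelayedKalman.centralFilter A C Ce R Re Pk x₀ y ye with hz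
  have hfil : ∀ k, DelayedKalman.IsFilter (DelayedKalman.info y ye k k) μ (x k) (z k) (Pk k) :=
    hs.isFilter_central hQ hR hRe hS₀
  have hxz : ∀ k, xbar k =ᵐ[μ] z k := fun k =>
    (hfil k).condExp_eq (hs.info_le_ambient _ _) (hs.measurable_state_ambient k)
      (hs.memLp_state hQ k)
  have hpred : ∀ (P : Matrix (Fin n) (Fin n) ℝ) d t,
      (fun ω => DelayedKalman.delayedPredictor A C Q R P d (d + t) (xbar (t + 1) ω)
        (fun i => y i ω)) =ᵐ[μ]
      (fun ω => DelayedKalman.delayedPredictor A C Q R P d (d + t) (z (t + 1) ω)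
        (fun i => y i ω)) := fun P d t => by
    filter_upwards [hxz (t + 1)] with ω hω
    rw [hω]
  have hdel := fun d t => hs.isFilter_delayed hQ hR (hPk (t + 1)) (hfil (t + 1)) d
  have hcond : ∀ d t, DelayedKalman.delayedCondExp μ x y ye d (d + t) =ᵐ[μ]
      (fun ω => DelayedKalman.delayedPredictor A C Q R (Pk (t + 1)) d (d + t) (z (t + 1) ω)
        (fun i => y i ω)) := fun d t => by
    have := (hdel d t).condExp_eq (hs.info_le_ambient _ _) (hs.measurable_state_ambient _)
      (hs.memLp_state hQ _)
    simpa only [DelayedKalman.delayedCondExp, Nat.add_sub_cancel_left] using this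
  have hmain : ∀ d k, d ≤ k →
      DelayedKalman.delayedCondExp μ x y ye d k =ᵐ[μ] (fun ω =>
        DelayedKalman.delayedPredictor A C Q R (Pk (k - d + 1)) d k
          (xbar (k - d + 1) ω) (fun i => y i ω)) ∧
      DelayedKalman.IsMMSEPredictor μ (DelayedKalman.info y ye (k + 1) (k - d + 1)) (x (k + 1))
        (fun ω => DelayedKalman.delayedPredictor A C Q R (Pk (k - d + 1)) d k
          (xbar (k - d + 1) ω) (fun i => y i ω)) := by
    intro d k hdk
    obtain ⟨t, rfl⟩ := Nat.exists_eq_add_of_le hdk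
    simp only [Nat.add_sub_cancel_left]
    refine ⟨(hcond d t).trans (hpred _ d t).symm, (hdel d t).isMMSEPredictor
      (hs.info_le_ambient _ _) (hs.measurable_state_ambient _) ?_ (hpred _ d t)⟩
    -- Conditional expectations are measurable everywhere in their σ-algebra, so the stated
    -- predictor is admissible as it stands, without passing to the recursive version `z`.
    have hx : Measurable[DelayedKalman.info y ye (d + t + 1) (t + 1)] (xbar (t + 1)) :=
      stronglyMeasurable_condExp.measurable.mono
        (DelayedKalman.info_mono (by omega) le_rfl) le_rfl
    refine ((DelayedKalman.measurable_toEuclideanLin _).comp hx).add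
      (Finset.measurable_sum _ fun l hl => (DelayedKalman.measurable_toEuclideanLin _).comp
        (DelayedKalman.measurable_info_local ?_))
    have := (Finset.mem_Icc.1 hl).2
    omega
  have hlim : Tendsto Pk atTop (𝓝 Pbar) :=
    DelayedKalman.ric_iterate_tendsto hQ hRR hPbar hfix hS₀
  refine ⟨hxz 0, fun k => ?_, hmain, hlim, fun d l _ =>
    DelayedKalman.transition_tendsto hQ hR hPbar hlim l (d - l),
    fun l _ => DelayedKalman.localGain_tendsto hQ hR hPbar hlim l, fun d => ?_, ?_⟩
  · filter_upwards [hxz (k + 1), hxz k] with ω h1 h2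
    rw [h1, h2]
    rfl
  -- Shifting to k = t + d discards the finitely many times k < d, where the subtraction is
  -- truncated.
  · rw [← tendsto_add_atTop_iff_nat d]
    have hgap := hs.tendsto_delayed_gap hQ hR hPk hPbar hlim hfil d
    have hsq := ((ENNReal.continuous_pow 2).tendsto 0).comp hgap
    rw [zero_pow two_ne_zero] at hsq
    refine hsq.congr fun t => ?_
    rw [add_comm t d, Nat.add_sub_cancel_left, Function.comp_apply,
      eLpNorm_eq_lintegral_rpow_enorm_toReal (by norm_num) (by norm_num), ← ENNReal.rpow_natCast,
      ← ENNReal.rpow_mul]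
    norm_num
    refine lintegral_congr_ae ?_
    filter_upwards [hcond d t, hpred Pbar d t] with ω h1 h2
    rw [h1, h2]
  -- Started at the fixed point, the covariance sequence is constant, so the exact formula already
  -- has P^(1) = Pbar.
  · rintro rfl d k hdk
    have hconst : ∀ k, Pk k = S₀ := fun k => Function.iterate_fixed hfix.symm k
    simpa only [hconst] using hmain d k hdk
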